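/- **Setting.** Let $R$, $\mathfrak m$, $I$, $\varphi$ be as in one of the following two cases. (a) $(R,\mathfrak m)$ is a regular local ring, $I$ is an ideal of $R$, and $\varphi\colon R\to R$ is a local ring endomorphism. (b) $R=k[x_1,\dots,x_n]$ is a standard graded polynomial ring over a field $k$, $\mathfrak m=(x_1,\dots,x_n)$, $I$ is a homogeneous ideal, and $\varphi\colon R\to R$ is a graded ring endomorphism, i.e. there is an integer $d\ge 1$ such that $\varphi(R_j)\subseteq R_{dj}$ for all $j\ge 0$ ($\varphi$ need not be $k$-linear). For $t\ge 0$ let $\varphi^t(I)R$ be the ideal generated by the image of $I$ under the $t$-th iterate of $\varphi$. The triple $(R,I,\varphi)$ is called a *cofinal flat triple* if $\varphi$ is flat, the ideals $\varphi^t(I)R$ $(t\ge 0)$ form a decreasing chain, and this chain is cofinal with $\{I^t\}_{t\ge 0}$ (for each $t$ there is an $s$ with $\varphi^s(I)R\subseteq I^t$, and for each $t$ there is an $s$ with $I^s\subseteq\varphi^t(I)R$). For such a triple, $R/I$ is called *$\varphi$-cohomologically Mittag-Leffler* ($\varphi$-cML) if for all $i\ge 0$ and $s\ge 0$ the natural map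 $$\varprojlim_t H^i_{\mathfrak m}\bigl(R/\varphi^t(I)R\bigr)\longrightarrow H^i_{\mathfrak m}\bigl(R/\varphi^s(I)R\bigr)$$ is surjective. **Proposition.** Let $(R,I,\varphi)$ be a cofinal flat triple, let $\widehat R=\varprojlim_n R/\mathfrak m^n$ be the $\mathfrak m$-adic completion, and let $\widehat\varphi\colon\widehat R\to\widehat R$ be the endomorphism induced by $\varphi$, i.e. the inverse limit of the maps $R/\mathfrak m^n\to R/\mathfrak m^n$ induced by $\varphi$. Then $\widehat R$ is a regular local ring, $\widehat\varphi$ is a flat local endomorphism, $(\widehat R, I\widehat R,\widehat\varphi)$ is again a cofinal flat triple, and $$R/I \text{ is } \varphi\text{-cML}\quad\Longleftrightarrow\quad \widehat R/I\widehat R \text{ is } \widehat\varphi\text{-cML}.$$ -/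

import Mathlib

open CategoryTheory Limits Opposite

universe u v

attribute [local instance] MvPolynomial.gradedAlgebra

noncomputable section

/-- `(R, I, φ)` is a cofinal flat triple: `φ : R → R` is flat, and the ideals `φ^t(I)R`, `t ≥ 0`,
form a decreasing chain cofinal with the chain of powers `I^t`. The ideal `φ^t(I)R` generated by
the image of `I` under the `t`-th iterate of `φ` is `I.map (φ ^ t)`. -/
structure IsCofinalFlatTriple {R : Type u} [CommRing R] (I : Ideal R) (φ : R →+* R) : Prop where
  flat : φ.Flat
  antitone : Antitone fun t : ℕ => I.map (φ ^ t)
  exists_map_le_pow : ∀ t : ℕ, ∃ s : ℕ, I.map (φ ^ s) ≤ I ^ t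
  exists_pow_le_map : ∀ t : ℕ, ∃ s : ℕ, I ^ s ≤ I.map (φ ^ t)

/-- The decreasing chain `t ↦ φ^t(I)R`, as an inverse system of ideals. -/
def IsCofinalFlatTriple.chain {R : Type u} [CommRing R] {I : Ideal R} {φ : R →+* R}
    (h : IsCofinalFlatTriple I φ) : ℕᵒᵖ ⥤ Ideal R where
  obj t := I.map (φ ^ t.unop)
  map w := homOfLE (h.antitone w.unop.le)

/-- The inverse system `t ↦ H^i_𝔪(R/φ^t(I)R)`, whose transition maps are induced by the natural
surjections `R/φ^t(I)R → R/φ^s(I)R`, `s ≤ t`. -/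
def IsCofinalFlatTriple.cohomologySystem {R : Type u} [CommRing R] {I : Ideal R} {φ : R →+* R}
    (h : IsCofinalFlatTriple I φ) (𝔪 : Ideal R) (i : ℕ) : ℕᵒᵖ ⥤ ModuleCat.{u} R :=
  localCohomology.ringModIdeals h.chain ⋙ localCohomology 𝔪 i

/-- For a cofinal flat triple `(R, I, φ)` and the distinguished maximal ideal `𝔪` of `R`, the
quotient `R/I` is `φ`-cohomologically Mittag-Leffler: for all `i` and `s`, the natural map
`lim_t H^i_𝔪(R/φ^t(I)R) → H^i_𝔪(R/φ^s(I)R)` is an epimorphism of `R`-modules. -/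
def IsCofinalFlatTriple.IsCML {R : Type u} [CommRing R] {I : Ideal R} {φ : R →+* R}
    (h : IsCofinalFlatTriple I φ) (𝔪 : Ideal R) : Prop :=
  ∀ i s : ℕ, Epi (limit.π (h.cohomologySystem 𝔪 i) (op s))

/-- If `φ(𝔪) ⊆ 𝔪`, then `φ(𝔪^n) ⊆ 𝔪^n` for all `n`. -/
lemma pow_le_comap_pow_of_le_comap {R : Type u} [CommRing R] {𝔪 : Ideal R} {φ : R →+* R}
    (hφ : 𝔪 ≤ 𝔪.comap φ) (n : ℕ) : 𝔪 ^ n ≤ (𝔪 ^ n).comap φ :=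
  (Ideal.pow_right_mono hφ n).trans (Ideal.le_comap_pow φ n)

/-- The map `R̂ → R/𝔪^n → R/𝔪^n`, the projection followed by the map induced by `φ`. -/
def completionMapAux {R : Type u} [CommRing R] {𝔪 : Ideal R} (φ : R →+* R)
    (hφ : 𝔪 ≤ 𝔪.comap φ) (n : ℕ) : AdicCompletion 𝔪 R →+* R ⧸ 𝔪 ^ n :=
  (Ideal.quotientMap (𝔪 ^ n) φ (pow_le_comap_pow_of_le_comap hφ n)).comp
    (AdicCompletion.evalₐ 𝔪 n : AdicCompletion 𝔪 R →+* R ⧸ 𝔪 ^ n)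

lemma factorPow_comp_completionMapAux {R : Type u} [CommRing R] {𝔪 : Ideal R} (φ : R →+* R)
    (hφ : 𝔪 ≤ 𝔪.comap φ) {m n : ℕ} (hle : m ≤ n) :
    (Ideal.Quotient.factorPow 𝔪 hle).comp (completionMapAux φ hφ n) =
      completionMapAux φ hφ m := by
  ext x
  obtain ⟨r, hr⟩ := Ideal.Quotient.mk_surjective (AdicCompletion.evalₐ 𝔪 n x)
  have hm : AdicCompletion.evalₐ 𝔪 m x = Ideal.Quotient.mk (𝔪 ^ m) r := by
    obtain ⟨y, rfl⟩ := AdicCompletion.mk_surjective 𝔪 R x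
    rw [AdicCompletion.evalₐ_mk] at hr ⊢
    have := congrArg (Ideal.Quotient.factorPow 𝔪 hle) hr
    rw [← AdicCompletion.Ideal.mk_eq_mk 𝔪 hle]
    simpa using this.symm
  simp [completionMapAux, ← hr, hm]

/-- The endomorphism `φ̂` of the `𝔪`-adic completion `R̂ = lim_n R/𝔪^n` induced by an endomorphism
`φ` of `R` with `φ(𝔪) ⊆ 𝔪`: the limit of the maps `R/𝔪^n → R/𝔪^n` induced by `φ`. -/
def completionMap {R : Type u} [CommRing R] {𝔪 : Ideal R} (φ : R →+* R)
    (hφ : 𝔪 ≤ 𝔪.comap φ) : AdicCompletion 𝔪 R →+* AdicCompletion 𝔪 R :=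
  AdicCompletion.liftRingHom 𝔪 (completionMapAux φ hφ) (factorPow_comp_completionMapAux φ hφ)

/-- Modulo `𝔪^n`, the map `φ̂` is the endomorphism of `R/𝔪^n` induced by `φ`. -/
lemma evalₐ_completionMap {R : Type u} [CommRing R] {𝔪 : Ideal R} (φ : R →+* R)
    (hφ : 𝔪 ≤ 𝔪.comap φ) (n : ℕ) (x : AdicCompletion 𝔪 R) :
    AdicCompletion.evalₐ 𝔪 n (completionMap φ hφ x) =
      Ideal.quotientMap (𝔪 ^ n) φ (pow_le_comap_pow_of_le_comap hφ n)
        (AdicCompletion.evalₐ 𝔪 n x) :=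
  AdicCompletion.evalₐ_liftRingHom 𝔪 _ (factorPow_comp_completionMapAux φ hφ) n x

/-- `φ̂` extends `φ` along the canonical map `R → R̂`. -/
lemma completionMap_algebraMap {R : Type u} [CommRing R] {𝔪 : Ideal R} (φ : R →+* R)
    (hφ : 𝔪 ≤ 𝔪.comap φ) (r : R) :
    completionMap φ hφ (algebraMap R (AdicCompletion 𝔪 R) r) =
      algebraMap R (AdicCompletion 𝔪 R) (φ r) := by
  apply AdicCompletion.ext_evalₐ
  intro n
  rw [evalₐ_completionMap, AlgHom.commutes, AlgHom.commutes]
  rfl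

/-- A local endomorphism of a local ring maps the maximal ideal into itself. -/
lemma maximalIdeal_le_comap_of_isLocalHom {R : Type u} [CommRing R] [IsLocalRing R]
    (φ : R →+* R) [IsLocalHom φ] :
    IsLocalRing.maximalIdeal R ≤ (IsLocalRing.maximalIdeal R).comap φ :=
  (IsLocalRing.maximalIdeal_comap φ).ge

/-- A ring endomorphism `φ` of the standard graded ring `S = k[x_1, …, x_n]` is graded if, for some
`d ≥ 1`, it maps `S_j` into `S_{dj}` for all `j` (it need not be `k`-linear). This covers the
`k`-linear substitutions `x_i ↦ x_i^d` and, in characteristic `p`, the Frobenius map. -/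
def IsGradedEndomorphism {n : ℕ} {k : Type v} [Field k]
    (φ : MvPolynomial (Fin n) k →+* MvPolynomial (Fin n) k) : Prop :=
  ∃ d : ℕ, 1 ≤ d ∧ ∀ (j : ℕ) (p : MvPolynomial (Fin n) k),
    p.IsHomogeneous j → (φ p).IsHomogeneous (d * j)

/-- A graded endomorphism maps the irrelevant ideal `(x_1, …, x_n)` into itself. -/
lemma idealOfVars_le_comap_of_isGradedEndomorphism {n : ℕ} {k : Type v} [Field k]
    {φ : MvPolynomial (Fin n) k →+* MvPolynomial (Fin n) k} (hφ : IsGradedEndomorphism φ) :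
    MvPolynomial.idealOfVars (Fin n) k ≤ (MvPolynomial.idealOfVars (Fin n) k).comap φ := by
  obtain ⟨d, hd, h⟩ := hφ
  rw [MvPolynomial.idealOfVars, Ideal.span_le]
  rintro _ ⟨i, rfl⟩
  have hX := h 1 _ (MvPolynomial.isHomogeneous_X k i)
  change φ (MvPolynomial.X i) ∈ MvPolynomial.idealOfVars (Fin n) k
  rw [← pow_one (MvPolynomial.idealOfVars (Fin n) k), MvPolynomial.mem_pow_idealOfVars_iff]
  intro x hx
  have := hX (MvPolynomial.mem_support_iff.mp hx)
  rw [Finsupp.degree_eq_weight_one (R := ℕ)]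
  change 1 ≤ Finsupp.weight 1 x
  rw [this, mul_one]
  exact hd

end

/-! Write S for the completion of R at 𝔪. Everything rests on two facts: R → S is flat, and R/𝔪^n →
S/𝔪^nS is an isomorphism for every n. The second is encoded by R-algebra maps θ : S → R/𝔪^n with
kernel inside 𝔪^nS.

Local cohomology of M is the colimit of Ext^i(R/𝔪^n, M). Computing Ext with free modules of finite
rank, flat base change gives S ⊗ Ext^i_R(R/𝔪^n, M) = Ext^i_S(S/𝔪^nS, S ⊗ M). This Ext is killed by
𝔪^n, so tensoring with S does not change it (`ModuleCat.extBaseChange_bijective`), and in the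
colimit H^i_𝔪(M) → H^i_{𝔪S}(S ⊗ M) is bijective (`localCohomologyBaseChange_bijective`). Since φ̂
extends φ, φ̂^t(IS) = φ^t(I)S; the bijections are natural, so they match the two inverse systems and
their limit projections are surjective together (`IsCofinalFlatTriple.isCML_iff`).

Flatness of φ̂ follows from a local criterion: its composite with R → S is flat, and R and S agree
modulo powers of 𝔪 (`Module.Flat.of_forall_algHom_quotient_pow`). S is Noetherian as a quotient of a
power series ring, and regular because 𝔪S has at most ht 𝔪 ≤ ht 𝔪S generators. Both cases of the
theorem enter only through a maximal ideal with at most ht 𝔪 generators in a Noetherian ring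
(`completion_isCML_iff`). -/

namespace CategoryTheory.ProjectiveResolution

/-! ### Ext classes represented by cocycles of a projective resolution -/

noncomputable section

universe w₁ v₁ u₁

variable {R : Type w₁} [Ring R] {C : Type u₁} [Category.{v₁} C] [Abelian C] [Linear R C]

variable (R) in
/-- The degree `n` cocycles of the complex `Hom(P, Y)`. -/
def cocycles {X : C} (P : ProjectiveResolution X) (n : ℕ) (Y : C) :
    Submodule R (P.complex.X n ⟶ Y) :=
  LinearMap.ker (Linear.leftComp R Y (P.complex.d (n + 1) n))

lemma mem_cocycles {X : C} (P : ProjectiveResolution X) {n : ℕ} {Y : C}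
    {f : P.complex.X n ⟶ Y} : f ∈ P.cocycles R n Y ↔ P.complex.d (n + 1) n ≫ f = 0 :=
  Iff.rfl

variable (R) in
/-- The complex `Hom(P, Y)`, as a chain complex in the opposite category of modules. -/
abbrev homComplex {X : C} (P : ProjectiveResolution X) (Y : C) :
    ChainComplex (ModuleCat.{v₁} R)ᵒᵖ ℕ :=
  (((linearYoneda R C).obj Y).rightOp.mapHomologicalComplex _).obj P.complex

variable (R) in
/-- The inclusion of the cocycles, seen in the opposite category. -/
def cocyclesι {X : C} (P : ProjectiveResolution X) (n : ℕ) (Y : C) :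
    (P.homComplex R Y).X n ⟶ op (ModuleCat.of R (P.cocycles R n Y)) :=
  (ModuleCat.ofHom (P.cocycles R n Y).subtype).op

lemma d_cocyclesι {X : C} (P : ProjectiveResolution X) (n : ℕ) (Y : C) :
    (P.homComplex R Y).d (n + 1) n ≫ P.cocyclesι R n Y = 0 := by
  apply Quiver.Hom.unop_inj
  ext f
  exact f.2

variable (R) in
/-- The map from opcycles of `homComplex` to the cocycles, in the opposite category. -/
def opcyclesToCocycles {X : C} (P : ProjectiveResolution X) (n : ℕ) (Y : C) :
    (P.homComplex R Y).opcycles n ⟶ op (ModuleCat.of R (P.cocycles R n Y)) :=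
  (P.homComplex R Y).descOpcycles (P.cocyclesι R n Y) (n + 1) (by simp) (P.d_cocyclesι n Y)

lemma p_opcyclesToCocycles {X : C} (P : ProjectiveResolution X) (n : ℕ) (Y : C) :
    (P.homComplex R Y).pOpcycles n ≫ P.opcyclesToCocycles R n Y = P.cocyclesι R n Y :=
  HomologicalComplex.p_descOpcycles _ _ _ _ _

/-- Ext is a left derived functor with values in the opposite category, so `unop` turns opcycles
into the kernel of the outgoing differential of Hom(P, Y). -/
lemma opcyclesToCocycles_unop_surjective {X : C} (P : ProjectiveResolution X) (n : ℕ) (Y : C) :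
    Function.Surjective (P.opcyclesToCocycles R n Y).unop := by
  intro z
  have hmono : Function.Injective ((P.homComplex R Y).pOpcycles n).unop :=
    (ModuleCat.mono_iff_injective _).1 inferInstance
  have hz : ((P.homComplex R Y).pOpcycles n).unop z ∈ P.cocycles R n Y := by
    have := congr(($((P.homComplex R Y).d_pOpcycles (n + 1) n)).unop z)
    exact this
  refine ⟨⟨_, hz⟩, hmono ?_⟩
  exact congr(($(P.p_opcyclesToCocycles (R := R) n Y)).unop ⟨_, hz⟩)

/-- Cocycles are functorial in the coefficients. -/
lemma comp_mem_cocycles {X : C} (P : ProjectiveResolution X) {n : ℕ} {Y Y' : C} (a : Y ⟶ Y')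
    {f : P.complex.X n ⟶ Y} (hf : f ∈ P.cocycles R n Y) : f ≫ a ∈ P.cocycles R n Y' := by
  rw [mem_cocycles] at *
  rw [reassoc_of% hf, zero_comp]

/-- Cocycles are functorial in the resolution. -/
lemma comp_mem_cocycles' {X X' : C} (P : ProjectiveResolution X) (P' : ProjectiveResolution X')
    (φ : P'.complex ⟶ P.complex) {n : ℕ} {Y : C} {f : P.complex.X n ⟶ Y}
    (hf : f ∈ P.cocycles R n Y) : φ.f n ≫ f ∈ P'.cocycles R n Y := by
  rw [mem_cocycles] at *
  rw [← HomologicalComplex.Hom.comm_assoc, hf, comp_zero]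

variable [EnoughProjectives C]

variable (R) in
/-- The derived functors of `Hom(-, Y)` as the homology of `homComplex`. -/
abbrev homComplexIso {X : C} (P : ProjectiveResolution X) (n : ℕ) (Y : C) :
    (((linearYoneda R C).obj Y).rightOp.leftDerived n).obj X ≅ (P.homComplex R Y).homology n :=
  P.isoLeftDerivedObj ((linearYoneda R C).obj Y).rightOp n

variable (R) in
/-- The class of a cocycle, in the opposite category. -/
def extOfCocycleOp {X : C} (P : ProjectiveResolution X) (n : ℕ) (Y : C) :
    (((linearYoneda R C).obj Y).rightOp.leftDerived n).obj X ⟶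
      op (ModuleCat.of R (P.cocycles R n Y)) :=
  (P.homComplexIso R n Y).hom ≫ (P.homComplex R Y).homologyι n ≫ P.opcyclesToCocycles R n Y

variable (R) in
/-- The class in `Ext` of a cocycle of a projective resolution. -/
def extOfCocycle {X : C} (P : ProjectiveResolution X) (n : ℕ) (Y : C) :
    ModuleCat.of R (P.cocycles R n Y) ⟶ ((Ext R C n).obj (op X)).obj Y :=
  (P.extOfCocycleOp R n Y).unop

lemma extOfCocycle_surjective {X : C} (P : ProjectiveResolution X) (n : ℕ) (Y : C) :
    Function.Surjective (P.extOfCocycle R n Y) := by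
  have h1 : Function.Surjective
      (P.homComplexIso R n Y).hom.unop :=
    (ModuleCat.epi_iff_surjective _).1 inferInstance
  have h2 : Function.Surjective ((P.homComplex R Y).homologyι n).unop :=
    (ModuleCat.epi_iff_surjective _).1 inferInstance
  exact h1.comp (h2.comp (P.opcyclesToCocycles_unop_surjective n Y))

/-- The index `next n` is n - 1 for n > 0; for n = 0 it is 0, where the differential is zero and so
are all coboundaries. -/
lemma extOfCocycle_eq_zero_iff {X : C} (P : ProjectiveResolution X) (n : ℕ) (Y : C)
    (f : P.cocycles R n Y) :
    P.extOfCocycle R n Y f = 0 ↔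
      ∃ g : P.complex.X ((ComplexShape.down ℕ).next n) ⟶ Y,
        P.complex.d n ((ComplexShape.down ℕ).next n) ≫ g = f.1 := by
  set K := P.homComplex R Y
  have h1 : Function.Injective
      (P.homComplexIso R n Y).hom.unop :=
    (ModuleCat.mono_iff_injective _).1 inferInstance
  have h2 : Function.Injective (K.pOpcycles n).unop :=
    (ModuleCat.mono_iff_injective _).1 inferInstance
  have key : P.extOfCocycle R n Y f = 0 ↔
      (K.homologyι n).unop ((P.opcyclesToCocycles R n Y).unop f) = 0 :=
    map_eq_zero_iff (P.homComplexIso R n Y).hom.unop.hom h1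
  have hp : (K.pOpcycles n).unop ((P.opcyclesToCocycles R n Y).unop f) = f.1 :=
    congr(($(P.p_opcyclesToCocycles (R := R) n Y)).unop f)
  rw [key]
  let S : ShortComplex (ModuleCat.{v₁} R)ᵒᵖ :=
    ShortComplex.mk _ _ (K.homologyι_comp_fromOpcycles n ((ComplexShape.down ℕ).next n))
  have hS : S.Exact := S.exact_of_f_is_kernel (K.homologyIsKernel n _ rfl)
  have hS' := (ShortComplex.moduleCat_exact_iff _).1 hS.unop
  have hd (g : P.complex.X ((ComplexShape.down ℕ).next n) ⟶ Y) :
      (K.pOpcycles n).unop ((K.fromOpcycles n _).unop g) =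
        P.complex.d n ((ComplexShape.down ℕ).next n) ≫ g :=
    congr(($(K.p_fromOpcycles n ((ComplexShape.down ℕ).next n))).unop g)
  constructor
  · intro h
    obtain ⟨g, hg⟩ := hS' _ h
    exact ⟨g, (hd g).symm.trans (congr((K.pOpcycles n).unop $hg).trans hp)⟩
  · rintro ⟨g, hg⟩
    rw [← hp, ← hd] at hg
    rw [← h2 hg]
    exact congr(($(K.homologyι_comp_fromOpcycles n ((ComplexShape.down ℕ).next n))).unop g)

lemma map_extOfCocycle {X : C} (P : ProjectiveResolution X) (n : ℕ) {Y Y' : C} (a : Y ⟶ Y')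
    (f : P.cocycles R n Y) :
    ((Ext R C n).obj (op X)).map a (P.extOfCocycle R n Y f) =
      P.extOfCocycle R n Y' ⟨f.1 ≫ a, P.comp_mem_cocycles a f.2⟩ := by
  let α : P.homComplex R Y' ⟶ P.homComplex R Y := (NatTrans.mapHomologicalComplex
    (NatTrans.rightOp ((linearYoneda R C).map a)) (ComplexShape.down ℕ)).app P.complex
  let c : P.cocycles R n Y →ₗ[R] P.cocycles R n Y' :=
    (Linear.rightComp R _ a).restrict fun f hf ↦ P.comp_mem_cocycles a hf
  have e1 : ((Ext R C n).obj (op X)).map a =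
      ((NatTrans.leftDerived (NatTrans.rightOp ((linearYoneda R C).map a)) n).app X).unop := rfl
  have e2 : (P.homComplexIso R n Y').hom ≫
      HomologicalComplex.homologyMap α n =
      ((NatTrans.leftDerived (NatTrans.rightOp ((linearYoneda R C).map a)) n).app X) ≫
      (P.homComplexIso R n Y).hom := by
    have := leftDerived_app_eq (NatTrans.rightOp ((linearYoneda R C).map a)) P n
    exact ((Iso.eq_comp_inv (P.homComplexIso R n Y)).1
      (this.trans (Category.assoc _ _ _).symm)).symm
  have e3 : HomologicalComplex.opcyclesMap α n ≫ P.opcyclesToCocycles R n Y =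
      P.opcyclesToCocycles R n Y' ≫ (ModuleCat.ofHom c).op := by
    rw [← cancel_epi ((P.homComplex R Y').pOpcycles n), ← Category.assoc, ← Category.assoc,
      HomologicalComplex.p_opcyclesMap, Category.assoc, p_opcyclesToCocycles,
      p_opcyclesToCocycles]
    rfl
  have e4 : ((NatTrans.leftDerived (NatTrans.rightOp ((linearYoneda R C).map a)) n).app X) ≫
      P.extOfCocycleOp R n Y = P.extOfCocycleOp R n Y' ≫ (ModuleCat.ofHom c).op := by
    simp only [extOfCocycleOp, Category.assoc]
    rw [← e3, ← HomologicalComplex.homologyι_naturality_assoc, reassoc_of% e2]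
  exact congr(($e4).unop f)

lemma map_op_extOfCocycle {X X' : C} (P : ProjectiveResolution X) (P' : ProjectiveResolution X')
    (a : X' ⟶ X) (φ : P'.complex ⟶ P.complex) (comm : φ.f 0 ≫ P.π.f 0 = P'.π.f 0 ≫ a)
    (n : ℕ) (Y : C) (f : P.cocycles R n Y) :
    ((Ext R C n).map a.op).app Y (P.extOfCocycle R n Y f) =
      P'.extOfCocycle R n Y ⟨φ.f n ≫ f.1, P.comp_mem_cocycles' P' φ f.2⟩ := by
  let F : C ⥤ (ModuleCat.{v₁} R)ᵒᵖ := ((linearYoneda R C).obj Y).rightOp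
  let α : P'.homComplex R Y ⟶ P.homComplex R Y := (F.mapHomologicalComplex (ComplexShape.down ℕ)).map φ
  let c : P.cocycles R n Y →ₗ[R] P'.cocycles R n Y :=
    (Linear.leftComp R _ (φ.f n)).restrict fun f hf ↦ P.comp_mem_cocycles' P' φ hf
  have e2 : (F.leftDerived n).map a ≫ (P.homComplexIso R n Y).hom =
      (P'.homComplexIso R n Y).hom ≫ HomologicalComplex.homologyMap α n :=
    isoLeftDerivedObj_hom_naturality a P' P φ comm F n
  have e3 : HomologicalComplex.opcyclesMap α n ≫ P.opcyclesToCocycles R n Y =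
      P'.opcyclesToCocycles R n Y ≫ (ModuleCat.ofHom c).op := by
    rw [← cancel_epi ((P'.homComplex R Y).pOpcycles n), ← Category.assoc, ← Category.assoc,
      HomologicalComplex.p_opcyclesMap, Category.assoc, p_opcyclesToCocycles,
      p_opcyclesToCocycles]
    rfl
  have e4 : (F.leftDerived n).map a ≫ P.extOfCocycleOp R n Y =
      P'.extOfCocycleOp R n Y ≫ (ModuleCat.ofHom c).op := by
    simp only [extOfCocycleOp, Category.assoc]
    rw [← e3, ← HomologicalComplex.homologyι_naturality_assoc, reassoc_of% e2]
  exact congr(($e4).unop f)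

end

end CategoryTheory.ProjectiveResolution

/-! ### Flat base change of homology killed by an ideal -/

section FlatBaseChange

open TensorProduct

variable {R S : Type*} [CommRing R] [CommRing S] [Algebra R S] {q : Ideal R}

/-- If `θ : S → R/q` is a map of `R`-algebras and `H` is killed by `q`, then `H → S ⊗ H` is
injective. -/
lemma eq_zero_of_one_tmul_eq_zero (θ : S →ₐ[R] R ⧸ q) {H : Type*} [AddCommGroup H] [Module R H]
    (hH : ∀ r ∈ q, ∀ x : H, r • x = 0) (x : H) (hx : (1 : S) ⊗ₜ[R] x = 0) : x = 0 := by
  -- Tensoring θ with H maps S ⊗ H to R/q ⊗ H = H/qH = H and sends 1 ⊗ x back to x.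
  have h1 : (1 : R ⧸ q) ⊗ₜ[R] x = 0 := by
    simpa using congr(LinearMap.rTensor H θ.toLinearMap $hx)
  have h2 := congr(TensorProduct.quotTensorEquivQuotSMul H q $h1)
  have h3 : (Submodule.Quotient.mk x : H ⧸ q • (⊤ : Submodule R H)) = 0 := by
    rw [map_zero] at h2
    rw [← h2]
    have := TensorProduct.quotTensorEquivQuotSMul_mk_tmul (M := H) q 1 x
    rw [one_smul] at this
    exact this.symm
  rw [Submodule.Quotient.mk_eq_zero] at h3
  have h4 : q • (⊤ : Submodule R H) ≤ ⊥ := Submodule.smul_le.2 fun r hr y _ ↦ by simp [hH r hr y]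
  simpa using h4 h3

variable {A₁ A₂ A₃ B₁ B₂ B₃ : Type*} [AddCommGroup A₁] [AddCommGroup A₂] [AddCommGroup A₃]
  [AddCommGroup B₁] [AddCommGroup B₂] [AddCommGroup B₃] [Module R A₁] [Module R A₂] [Module R A₃]
  [Module R B₁] [Module R B₂] [Module R B₃] [Module S B₁] [Module S B₂] [Module S B₃]
  [IsScalarTower R S B₁] [IsScalarTower R S B₂] [IsScalarTower R S B₃]
  {u₁ : A₁ →ₗ[R] B₁} {u₂ : A₂ →ₗ[R] B₂} {u₃ : A₃ →ₗ[R] B₃}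
  {d₁ : A₁ →ₗ[R] A₂} {d₂ : A₂ →ₗ[R] A₃} {e₁ : B₁ →ₗ[S] B₂} {e₂ : B₂ →ₗ[S] B₃}

/-- Flat base change does not kill homology classes in a homology module killed by `q`. -/
lemma IsBaseChange.exists_eq_of_exists_map_eq [Module.Flat R S] (θ : S →ₐ[R] R ⧸ q)
    (h₁ : IsBaseChange S u₁) (h₂ : IsBaseChange S u₂)
    (c₁ : ∀ x, e₁ (u₁ x) = u₂ (d₁ x))
    (hq : ∀ r ∈ q, ∀ x, d₂ x = 0 → ∃ y, d₁ y = r • x)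
    {x : A₂} (hx : d₂ x = 0) {y : B₁} (hy : e₁ y = u₂ x) : ∃ z, d₁ z = x := by
  let x' : A₂ ⧸ LinearMap.range d₁ := Submodule.Quotient.mk x
  -- The whole cokernel of d₁ need not be killed by q, but the class of the cycle x is. Flatness
  -- embeds S ⊗ N into S ⊗ coker d₁, so the vanishing of 1 ⊗ x' can be tested in S ⊗ N.
  let N : Submodule R (A₂ ⧸ LinearMap.range d₁) := Submodule.span R {x'}
  have hN : ∀ r ∈ q, ∀ z : N, r • z = 0 := by
    rintro r hr ⟨z, hz⟩
    obtain ⟨s, rfl⟩ := Submodule.mem_span_singleton.1 hz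
    ext
    obtain ⟨w, hw⟩ := hq r hr x hx
    have : r • x' = 0 := (Submodule.Quotient.mk_eq_zero _).2 ⟨w, hw⟩
    simp [smul_comm r s, this]
  have hexact : Function.Exact (d₁.lTensor S) ((LinearMap.range d₁).mkQ.lTensor S) :=
    lTensor_exact S (LinearMap.exact_map_mkQ_range d₁) (Submodule.mkQ_surjective _)
  have hequiv (t : S ⊗[R] A₁) : h₂.equiv (d₁.lTensor S t) = e₁ (h₁.equiv t) := by
    induction t with
    | zero => simp
    | add a b ha hb => simp only [map_add, ha, hb]
    | tmul s a => simp [h₁.equiv_tmul, h₂.equiv_tmul, c₁]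
  have htmul : (1 : S) ⊗ₜ[R] x = d₁.lTensor S (h₁.equiv.symm y) := by
    apply h₂.equiv.injective
    rw [hequiv, LinearEquiv.apply_symm_apply, hy, h₂.equiv_tmul, one_smul]
  have h0 : (1 : S) ⊗ₜ[R] (⟨x', Submodule.mem_span_singleton_self x'⟩ : N) = 0 := by
    apply Module.Flat.lTensor_preserves_injective_linearMap (M := S) N.subtype
      N.injective_subtype
    have := hexact.apply_apply_eq_zero (h₁.equiv.symm y)
    rw [← htmul] at this
    simpa using this
  have := congr(($(eq_zero_of_one_tmul_eq_zero θ hN _ h0) : A₂ ⧸ LinearMap.range d₁))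
  exact (Submodule.Quotient.mk_eq_zero _).1 this

omit [IsScalarTower R S B₁] in
/-- Flat base change is surjective on homology when the homology is killed by `q`. -/
lemma IsBaseChange.exists_sub_eq [Module.Flat R S] (θ : S →ₐ[R] R ⧸ q)
    (hθ : RingHom.ker θ ≤ q.map (algebraMap R S))
    (h₂ : IsBaseChange S u₂) (h₃ : IsBaseChange S u₃)
    (c₁ : ∀ x, e₁ (u₁ x) = u₂ (d₁ x)) (c₂ : ∀ x, e₂ (u₂ x) = u₃ (d₂ x))
    (hq : ∀ r ∈ q, ∀ x, d₂ x = 0 → ∃ y, d₁ y = r • x)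
    {y : B₂} (hy : e₂ y = 0) : ∃ x, d₂ x = 0 ∧ ∃ z, e₁ z = y - u₂ x := by
  let w : LinearMap.ker d₂ →ₗ[R] LinearMap.ker e₂ :=
    { toFun := fun x ↦ ⟨u₂ x, by
        rw [LinearMap.mem_ker, c₂, LinearMap.mem_ker.1 x.2, map_zero]⟩
      map_add' := fun a b ↦ by ext; simp
      map_smul' := fun a b ↦ by ext; simp }
  -- Kernels commute with flat base change, so it is enough to treat the cycles s ⊗ a.
  have hw : IsBaseChange S w :=
    IsBaseChange.of_left_exact S w u₂ u₃ (f := (LinearMap.ker d₂).subtype) (g := d₂)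
      (f' := (LinearMap.ker e₂).subtype) (g' := e₂) rfl (by ext x; exact (c₂ x).symm) h₂ h₃
      (LinearMap.exact_subtype_ker_map d₂) (Submodule.injective_subtype _)
      (LinearMap.exact_subtype_ker_map e₂) (Submodule.injective_subtype _)
  suffices H : ∀ y : LinearMap.ker e₂, ∃ x, d₂ x = 0 ∧ ∃ z, e₁ z = y - u₂ x from H ⟨y, hy⟩
  intro y
  obtain ⟨t, rfl⟩ := hw.equiv.surjective y
  induction t with
  | zero => exact ⟨0, by simp, 0, by simp⟩
  | add a b ha hb =>
    obtain ⟨x, hx, z, hz⟩ := ha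
    obtain ⟨x', hx', z', hz'⟩ := hb
    exact ⟨x + x', by simp [hx, hx'], z + z', by simp [hz, hz']; abel⟩
  | tmul s a =>
    -- Modulo qS the scalar s comes from some r in R, and qS maps the cycle u₂ a into boundaries;
    -- hence s ⊗ a is homologous to the image of r • a.
    obtain ⟨r, hr⟩ := Ideal.Quotient.mk_surjective (θ s)
    have hs : s - algebraMap R S r ∈ q.map (algebraMap R S) := hθ (by
      rw [RingHom.mem_ker, map_sub, AlgHom.commutes, ← hr, Ideal.Quotient.algebraMap_eq, sub_self])
    refine ⟨r • a, by simp, ?_⟩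
    rw [hw.equiv_tmul]
    have : ∀ t ∈ q.map (algebraMap R S), ∃ z, e₁ z = t • u₂ a := by
      intro t ht
      induction ht using Submodule.span_induction with
      | zero => exact ⟨0, by simp⟩
      | add a b _ _ ha hb =>
        obtain ⟨z, hz⟩ := ha
        obtain ⟨z', hz'⟩ := hb
        exact ⟨z + z', by rw [map_add, hz, hz', add_smul]⟩
      | smul c t _ ht =>
        obtain ⟨z, hz⟩ := ht
        exact ⟨c • z, by rw [map_smul, hz, smul_assoc]⟩
      | mem t ht =>
        obtain ⟨r, hr, rfl⟩ := ht
        obtain ⟨y, hy⟩ := hq r hr a a.2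
        exact ⟨u₁ y, by rw [c₁, hy, map_smul, algebraMap_smul]⟩
    obtain ⟨z, hz⟩ := this _ hs
    refine ⟨z, ?_⟩
    rw [hz, sub_smul, algebraMap_smul, map_smul]
    rfl

end FlatBaseChange

/-! ### Free resolutions, of finite rank for finite modules over Noetherian rings -/

noncomputable section

namespace ModuleCat

variable {R : Type u} [CommRing R]

/-- The case split makes one choice of cover serve all modules while staying of finite rank on
finite ones. -/
lemma exists_epi_of_free (N : ModuleCat.{u} R) : ∃ (F : ModuleCat.{u} R) (p : F ⟶ N),
    Module.Free R F ∧ (Module.Finite R N → Module.Finite R F) ∧ Epi p := by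
  by_cases h : Module.Finite R N
  · obtain ⟨n, f, hf⟩ := Module.Finite.exists_fin' R N
    exact ⟨of R (Fin n → R), ofHom f, inferInstanceAs (Module.Free R (Fin n → R)),
      fun _ ↦ inferInstanceAs (Module.Finite R (Fin n → R)), (epi_iff_surjective _).2 hf⟩
  · exact ⟨of R (N →₀ R), ofHom (Finsupp.linearCombination R id),
      inferInstanceAs (Module.Free R (N →₀ R)), fun h' ↦ (h h').elim,
      (epi_iff_surjective _).2 (Finsupp.linearCombination_id_surjective R N)⟩

/-- A free module mapping onto `N`, of finite rank if `N` is finitely generated. -/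
def freeCover (N : ModuleCat.{u} R) : ModuleCat.{u} R :=
  (exists_epi_of_free N).choose

/-- The projection of `freeCover`. -/
def freeCoverπ (N : ModuleCat.{u} R) : freeCover N ⟶ N :=
  (exists_epi_of_free N).choose_spec.choose

instance (N : ModuleCat.{u} R) : Module.Free R (freeCover N) :=
  (exists_epi_of_free N).choose_spec.choose_spec.1

instance (N : ModuleCat.{u} R) [h : Module.Finite R N] : Module.Finite R (freeCover N) :=
  (exists_epi_of_free N).choose_spec.choose_spec.2.1 h

instance (N : ModuleCat.{u} R) : Epi (freeCoverπ N) :=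
  (exists_epi_of_free N).choose_spec.choose_spec.2.2

instance (N : ModuleCat.{u} R) : Projective (freeCover N) :=
  have := Module.Projective.of_free (R := R) (P := freeCover N)
  (IsProjective.iff_projective (freeCover N)).1 this

/-- The composite of `freeCover (kernel f) ⟶ kernel f ⟶ X`. -/
def freeSyzygyMap {X Y : ModuleCat.{u} R} (f : X ⟶ Y) : freeCover (kernel f) ⟶ X :=
  freeCoverπ (kernel f) ≫ kernel.ι f

lemma freeSyzygyMap_comp {X Y : ModuleCat.{u} R} (f : X ⟶ Y) : freeSyzygyMap f ≫ f = 0 := by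
  simp [freeSyzygyMap]

lemma exact_freeSyzygyMap {X Y : ModuleCat.{u} R} (f : X ⟶ Y) :
    (ShortComplex.mk (freeSyzygyMap f) f (freeSyzygyMap_comp f)).Exact := by
  let α : ShortComplex.mk (freeSyzygyMap f) f (freeSyzygyMap_comp f) ⟶
      ShortComplex.mk (kernel.ι f) f (by simp) :=
    { τ₁ := freeCoverπ _
      τ₂ := 𝟙 _
      τ₃ := 𝟙 _
      comm₁₂ := by simp [freeSyzygyMap] }
  have : Epi α.τ₁ := inferInstanceAs (Epi (freeCoverπ _))
  rw [ShortComplex.exact_iff_of_epi_of_isIso_of_mono α]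
  exact ShortComplex.exact_of_f_is_kernel _ (kernelIsKernel f)

instance {X Y : ModuleCat.{u} R} (f : X ⟶ Y) [IsNoetherianRing R] [Module.Finite R X] :
    Module.Finite R (kernel f : ModuleCat.{u} R) :=
  Module.Finite.of_injective (kernel.ι f).hom ((mono_iff_injective _).1 inferInstance)

/-- The differentials of the resolution of `N` obtained by iterating `freeSyzygyMap`, starting with
the augmentation. -/
def freeArrow (N : ModuleCat.{u} R) : ℕ → Arrow (ModuleCat.{u} R)
  | 0 => Arrow.mk (freeCoverπ N)
  | n + 1 => Arrow.mk (freeSyzygyMap (freeArrow N n).hom)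

/-- The differentials of `freeComplex`. -/
def freeD (N : ModuleCat.{u} R) (n : ℕ) : (freeArrow N (n + 1)).left ⟶ (freeArrow N n).left :=
  freeSyzygyMap (freeArrow N n).hom

/-- The complex of free modules obtained by iterating `freeSyzygyMap`. -/
def freeComplex (N : ModuleCat.{u} R) : ChainComplex (ModuleCat.{u} R) ℕ :=
  ChainComplex.of (fun n ↦ (freeArrow N n).left) (freeD N)
    fun n ↦ freeSyzygyMap_comp (freeD N n)

lemma freeComplex_d_one_zero (N : ModuleCat.{u} R) :
    (freeComplex N).d 1 0 = freeSyzygyMap (freeCoverπ N) :=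
  ChainComplex.of_d (fun n ↦ (freeArrow N n).left) (freeD N) 0

lemma _root_.ChainComplex.exactAt_of {C : Type*} [Category* C] [HasZeroMorphisms C]
    (X : ℕ → C) (d : ∀ n, X (n + 1) ⟶ X n) (sq : ∀ n, d (n + 1) ≫ d n = 0) (n : ℕ)
    (h : (ShortComplex.mk (d (n + 1)) (d n) (sq n)).Exact) :
    (ChainComplex.of X d sq).ExactAt (n + 1) := by
  rw [HomologicalComplex.exactAt_iff' _ (n + 1 + 1) (n + 1) n (by simp) (by simp)]
  -- The differentials of `ChainComplex.of` are supplied with equations to d; generalizing over them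
  -- lets these be substituted.
  have key : ∀ (f : X (n + 1 + 1) ⟶ X (n + 1)) (g : X (n + 1) ⟶ X n) (w : f ≫ g = 0),
      f = d (n + 1) → g = d n → (ShortComplex.mk f g w).Exact := by
    rintro _ _ _ rfl rfl
    exact h
  exact key _ _ ((ChainComplex.of X d sq).d_comp_d _ _ _) (ChainComplex.of_d ..)
    (ChainComplex.of_d ..)

lemma freeComplex_exactAt_succ (N : ModuleCat.{u} R) (n : ℕ) :
    (freeComplex N).ExactAt (n + 1) := by
  have key : ∀ (f : freeCover (kernel (freeD N n)) ⟶ (freeArrow N (n + 1)).left)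
      (w : f ≫ freeD N n = 0), f = freeSyzygyMap (freeD N n) →
      (ShortComplex.mk f (freeD N n) w).Exact := by
    rintro _ _ rfl
    exact exact_freeSyzygyMap _
  exact ChainComplex.exactAt_of (fun n ↦ (freeArrow N n).left) (freeD N)
    (fun n ↦ freeSyzygyMap_comp (freeD N n)) n
    (key (freeD N (n + 1)) (freeSyzygyMap_comp (freeD N n)) rfl)

lemma free_freeComplex_X (N : ModuleCat.{u} R) (n : ℕ) : Module.Free R ((freeComplex N).X n) := by
  cases n with
  | zero => exact inferInstanceAs (Module.Free R (freeCover N))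
  | succ n => exact inferInstanceAs (Module.Free R (freeCover (kernel (freeArrow N n).hom)))

lemma finite_freeComplex_X [IsNoetherianRing R] (N : ModuleCat.{u} R) [Module.Finite R N] (n : ℕ) :
    Module.Finite R ((freeComplex N).X n) := by
  induction n with
  | zero => exact inferInstanceAs (Module.Finite R (freeCover N))
  | succ n ih =>
    have : Module.Finite R (freeArrow N n).left := ih
    exact inferInstanceAs (Module.Finite R (freeCover (kernel (freeArrow N n).hom)))

/-- The augmentation of `freeComplex`. -/
def freeComplexπ (N : ModuleCat.{u} R) : freeComplex N ⟶ (ChainComplex.single₀ _).obj N :=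
  (ChainComplex.toSingle₀Equiv _ _).symm
    ⟨freeCoverπ N, (congrArg (· ≫ freeCoverπ N) (freeComplex_d_one_zero N)).trans
      (freeSyzygyMap_comp _)⟩

lemma freeComplexπ_f_zero (N : ModuleCat.{u} R) : (freeComplexπ N).f 0 = freeCoverπ N :=
  ChainComplex.toSingle₀Equiv_symm_apply_f_zero _ _

lemma quasiIsoAt_zero_freeComplexπ (N : ModuleCat.{u} R) : QuasiIsoAt (freeComplexπ N) 0 := by
  rw [ChainComplex.quasiIsoAt₀_iff, ShortComplex.quasiIso_iff_of_zeros' _ rfl rfl rfl]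
  have key : ∀ (f : freeCover (kernel (freeCoverπ N)) ⟶ freeCover N) (g : freeCover N ⟶ N)
      (w : f ≫ g = 0), f = freeSyzygyMap (freeCoverπ N) → g = freeCoverπ N →
      (ShortComplex.mk f g w).Exact ∧ Epi g := by
    rintro _ _ _ rfl rfl
    exact ⟨exact_freeSyzygyMap _, inferInstance⟩
  exact key _ _ _ (freeComplex_d_one_zero N) (freeComplexπ_f_zero N)

/-- A resolution by free modules, of finite rank if `R` is Noetherian and `N` is finitely
generated. -/
def freeResolution (N : ModuleCat.{u} R) : ProjectiveResolution N where
  complex := freeComplex N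
  projective n :=
    have := free_freeComplex_X N n
    have := Module.Projective.of_free (R := R) (P := (freeComplex N).X n)
    (IsProjective.iff_projective _).1 this
  π := freeComplexπ N
  quasiIso := ⟨fun n ↦ by
    cases n with
    | zero => exact quasiIsoAt_zero_freeComplexπ N
    | succ n =>
      rw [quasiIsoAt_iff_exactAt']
      · apply freeComplex_exactAt_succ
      · apply ChainComplex.exactAt_succ_single_obj⟩

instance (N : ModuleCat.{u} R) (n : ℕ) : Module.Free R ((freeResolution N).complex.X n) :=
  free_freeComplex_X N n

instance [IsNoetherianRing R] (N : ModuleCat.{u} R) [Module.Finite R N] (n : ℕ) :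
    Module.Finite R ((freeResolution N).complex.X n) :=
  finite_freeComplex_X N n

end ModuleCat

end

/-! ### Base change of projective resolutions -/

noncomputable section

open TensorProduct

namespace CategoryTheory.ProjectiveResolution

variable {C : Type*} [Category* C] [Abelian C]

/-- A projective resolution of an isomorphic object. -/
def ofIso {Z Z' : C} (P : ProjectiveResolution Z) (e : Z ≅ Z') : ProjectiveResolution Z' where
  complex := P.complex
  π := P.π ≫ (ChainComplex.single₀ C).map e.hom

end CategoryTheory.ProjectiveResolution

namespace ModuleCat

variable (R S : Type u) [CommRing R] [CommRing S] [Algebra R S]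

/-- The functor `S ⊗[R] -`. -/
def baseChange : ModuleCat.{u} R ⥤ ModuleCat.{u} S where
  obj M := of S (S ⊗[R] M)
  map f := ofHom (f.hom.baseChange S)
  map_id M := by ext : 1; exact LinearMap.baseChange_id
  map_comp f g := by ext : 1; exact LinearMap.baseChange_comp _ _

instance : (baseChange R S).Additive where
  map_add := by
    intros
    ext : 1
    exact LinearMap.baseChange_add _ _

instance : (baseChange R S).PreservesProjectiveObjects where
  projective_obj {M} hM := by
    have : Module.Projective R M := (IsProjective.iff_projective M).2 hM
    have : Module.Projective S (S ⊗[R] M) := Module.Projective.tensorProduct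
    exact (IsProjective.iff_projective (of S (S ⊗[R] M))).1 this

instance [Module.Flat R S] : (baseChange R S).PreservesHomology := by
  refine ((Functor.exact_tfae (baseChange R S)).out 1 2).1 fun T hT ↦ ?_
  rw [ShortComplex.ShortExact.moduleCat_exact_iff_function_exact] at hT ⊢
  exact Module.Flat.lTensor_exact S hT

variable {R S}

section

variable [Module.Flat R S] {N : ModuleCat.{u} R} {N' : ModuleCat.{u} S}

/-- The base change of a projective resolution along a flat map. -/
def baseChangeResolution (P : ProjectiveResolution N) (a : (baseChange R S).obj N ≅ N') :
    ProjectiveResolution N' :=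
  ((baseChange R S).mapProjectiveResolution P).ofIso a

lemma baseChangeResolution_π_f_zero (P : ProjectiveResolution N)
    (a : (baseChange R S).obj N ≅ N') :
    (baseChangeResolution P a).π.f 0 = (baseChange R S).map (P.π.f 0) ≫ a.hom := by
  simp [baseChangeResolution, ProjectiveResolution.ofIso]
  rfl

end

end ModuleCat

end

/-! ### Flat base change for Ext -/

noncomputable section

open TensorProduct

namespace ModuleCat

variable {R S : Type u} [CommRing R] [CommRing S] [Algebra R S]

section

lemma baseChange_obj_hom_ext {L : ModuleCat.{u} R} {M' : ModuleCat.{u} S} {f g : (baseChange R S).obj L ⟶ M'}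
    (h : ∀ x : L, f.hom ((1 : S) ⊗ₜ[R] x) = g.hom ((1 : S) ⊗ₜ[R] x)) : f = g := by
  ext : 1
  exact (TensorProduct.isBaseChange R L S).algHom_ext _ _ h

variable {L L₂ M M₂ : ModuleCat.{u} R} {M' M₂' : ModuleCat.{u} S}
  [Module R M'] [IsScalarTower R S M'] [Module R M₂'] [IsScalarTower R S M₂']

/-- The map `S ⊗ L ⟶ M'` induced by `f : L ⟶ M` and an `R`-linear map `u : M → M'`. -/
def baseChangeHom (u : M →ₗ[R] M') (f : L ⟶ M) : (baseChange R S).obj L ⟶ M' :=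
  ofHom ((TensorProduct.isBaseChange R L S).linearMapLeftRightHom u f.hom)

lemma baseChangeHom_one_tmul (u : M →ₗ[R] M') (f : L ⟶ M) (x : L) :
    (baseChangeHom u f).hom ((1 : S) ⊗ₜ[R] x) = u (f x) :=
  IsBaseChange.linearMapLeftRightHom_comp_apply (TensorProduct.isBaseChange R L S) u f.hom x

lemma baseChange_map_comp_baseChangeHom (u : M →ₗ[R] M') (g : L₂ ⟶ L) (f : L ⟶ M) :
    (baseChange R S).map g ≫ baseChangeHom u f = baseChangeHom u (g ≫ f) := by
  refine baseChange_obj_hom_ext fun x ↦ ?_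
  exact (baseChangeHom_one_tmul u f (g x)).trans (baseChangeHom_one_tmul u (g ≫ f) x).symm

lemma baseChangeHom_comp (u : M →ₗ[R] M') (u₂ : M₂ →ₗ[R] M₂') (b : M ⟶ M₂) (b' : M' ⟶ M₂')
    (h : ∀ x, b' (u x) = u₂ (b x)) (f : L ⟶ M) :
    baseChangeHom u f ≫ b' = baseChangeHom u₂ (f ≫ b) := by
  refine baseChange_obj_hom_ext fun x ↦ ?_
  exact (congrArg b' (baseChangeHom_one_tmul u f x)).trans
    ((h _).trans (baseChangeHom_one_tmul u₂ (f ≫ b) x).symm)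

lemma baseChangeHom_zero (u : M →ₗ[R] M') : baseChangeHom u (0 : L ⟶ M) = 0 :=
  baseChange_obj_hom_ext fun x ↦ (baseChangeHom_one_tmul u 0 x).trans (map_zero u)

lemma baseChangeHom_sub (u : M →ₗ[R] M') (f g : L ⟶ M) :
    baseChangeHom u (f - g) = baseChangeHom u f - baseChangeHom u g :=
  baseChange_obj_hom_ext fun x ↦ (baseChangeHom_one_tmul u (f - g) x).trans <|
    (map_sub u (f x) (g x)).trans
      (congr($(baseChangeHom_one_tmul u f x) - $(baseChangeHom_one_tmul u g x))).symm

end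

variable {N N₂ : ModuleCat.{u} R} {N' N₂' : ModuleCat.{u} S}
  {M M₂ : ModuleCat.{u} R} {M' M₂' : ModuleCat.{u} S}
  [Module R M'] [IsScalarTower R S M'] [Module R M₂'] [IsScalarTower R S M₂']

/-- If `r` kills `N`, it maps cocycles of a resolution of `N` to coboundaries. -/
lemma exists_comp_eq_smul (P : ProjectiveResolution N) {r : R} (hr : ∀ x : N, r • x = 0) {i : ℕ}
    {f : P.complex.X i ⟶ M} (hf : P.complex.d (i + 1) i ≫ f = 0) :
    ∃ g : P.complex.X ((ComplexShape.down ℕ).next i) ⟶ M,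
      P.complex.d i ((ComplexShape.down ℕ).next i) ≫ g = r • f := by
  let f' : P.cocycles R i M := ⟨f, hf⟩
  suffices P.extOfCocycle R i M (r • f') = 0 from (P.extOfCocycle_eq_zero_iff i M _).1 this
  -- Multiplication by r is zero on N, so both r • 𝟙 and 0 on P lift the zero endomorphism of N and
  -- act equally on Ext.
  have h1 := P.map_op_extOfCocycle P 0 (r • 𝟙 _) (by
    refine Eq.trans ?_ comp_zero.symm
    ext x
    exact (map_smul (P.π.f 0).hom r x).trans (hr _)) i M f'
  have h2 := P.map_op_extOfCocycle P 0 0 (zero_comp.trans comp_zero.symm) i M f'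
  have h3 : P.extOfCocycle R i M (r • f') =
      P.extOfCocycle R i M ⟨(r • 𝟙 P.complex : P.complex ⟶ P.complex).f i ≫ f'.1,
        P.comp_mem_cocycles' P _ f'.2⟩ := by
    congr 1
    ext : 1
    change r • f = (r • 𝟙 (P.complex.X i)) ≫ f
    rw [Linear.smul_comp, Category.id_comp]
  have h4 : (⟨(0 : P.complex ⟶ P.complex).f i ≫ f'.1,
      P.comp_mem_cocycles' P _ f'.2⟩ : P.cocycles R i M) = 0 := by
    ext : 1
    exact zero_comp
  rw [h3, ← h1, h2, h4, map_zero]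

variable [Module.Flat R S]

lemma baseChangeHom_mem_cocycles (P : ProjectiveResolution N) (a : (baseChange R S).obj N ≅ N')
    (u : M →ₗ[R] M') {i : ℕ} {f : P.complex.X i ⟶ M} (hf : f ∈ P.cocycles R i M) :
    baseChangeHom u f ∈ (baseChangeResolution P a).cocycles S i M' := by
  rw [ProjectiveResolution.mem_cocycles] at *
  exact (baseChange_map_comp_baseChangeHom u _ f).trans (by rw [hf, baseChangeHom_zero]; rfl)

/-- The map `Ext_R(N, M) → Ext_S(N', M')` induced by an isomorphism `S ⊗ N ≅ N'` and an `R`-linear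
map `M → M'`. -/
def extBaseChange (P : ProjectiveResolution N) (a : (baseChange R S).obj N ≅ N')
    (u : M →ₗ[R] M') (i : ℕ) (x : ((Ext R (ModuleCat.{u} R) i).obj (op N)).obj M) :
    ((Ext S (ModuleCat.{u} S) i).obj (op N')).obj M' :=
  (baseChangeResolution P a).extOfCocycle S i M'
    ⟨_, baseChangeHom_mem_cocycles P a u (P.extOfCocycle_surjective i M x).choose.2⟩

/-- Base change sends coboundaries to coboundaries, so the chosen representative does not matter. -/
lemma extBaseChange_extOfCocycle (P : ProjectiveResolution N) (a : (baseChange R S).obj N ≅ N')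
    (u : M →ₗ[R] M') (i : ℕ) (f : P.cocycles R i M) :
    extBaseChange P a u i (P.extOfCocycle R i M f) =
      (baseChangeResolution P a).extOfCocycle S i M'
        ⟨_, baseChangeHom_mem_cocycles P a u f.2⟩ := by
  have h := (P.extOfCocycle_surjective i M (P.extOfCocycle R i M f)).choose_spec
  rw [extBaseChange]
  set g := (P.extOfCocycle_surjective i M (P.extOfCocycle R i M f)).choose
  rw [← sub_eq_zero, ← map_sub, ProjectiveResolution.extOfCocycle_eq_zero_iff] at h ⊢
  obtain ⟨k, hk⟩ := h
  refine ⟨baseChangeHom u k, ?_⟩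
  refine (baseChange_map_comp_baseChangeHom u _ k).trans ?_
  rw [hk]
  exact baseChangeHom_sub u _ _

/-- Flat base change for `Ext` out of a finitely generated module killed by an ideal `q` such that
`R/q → S/qS` is an isomorphism. -/
lemma extBaseChange_bijective (P : ProjectiveResolution N)
    [∀ i, Module.Free R (P.complex.X i)] [∀ i, Module.Finite R (P.complex.X i)]
    (a : (baseChange R S).obj N ≅ N') {q : Ideal R} (hN : ∀ r ∈ q, ∀ x : N, r • x = 0)
    (θ : S →ₐ[R] R ⧸ q) (hθ : RingHom.ker θ ≤ q.map (algebraMap R S))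
    {u : M →ₗ[R] M'} (hu : IsBaseChange S u) (i : ℕ) :
    Function.Bijective (extBaseChange P a u i) := by
  let A (j : ℕ) := P.complex.X j →ₗ[R] M
  let B (j : ℕ) := (S ⊗[R] P.complex.X j) →ₗ[S] M'
  let w (j : ℕ) : A j →ₗ[R] B j :=
    (TensorProduct.isBaseChange R (P.complex.X j) S).linearMapLeftRightHom u
  -- Here the P_j must be free of finite rank: only then does Hom(P_j, -) commute with base change
  -- in this way.
  have hw (j : ℕ) : IsBaseChange S (w j) :=
    (TensorProduct.isBaseChange R (P.complex.X j) S).linearMapLeftRight hu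
  let d (j k : ℕ) : A k →ₗ[R] A j := (P.complex.d j k).hom.lcomp R M
  let e (j k : ℕ) : B k →ₗ[S] B j := ((P.complex.d j k).hom.baseChange S).lcomp S M'
  have hc (j k : ℕ) (f : A k) : e j k (w k f) = w j (d j k f) :=
    congr(Hom.hom $(baseChange_map_comp_baseChangeHom u (P.complex.d j k) (ofHom f)))
  have hq : ∀ r ∈ q, ∀ f : A i, d (i + 1) i f = 0 →
      ∃ g, d i ((ComplexShape.down ℕ).next i) g = r • f := by
    intro r hr f hf
    obtain ⟨g, hg⟩ := exists_comp_eq_smul P (hN r hr) (f := ofHom f) (hom_ext hf)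
    exact ⟨g.hom, congr(Hom.hom $hg)⟩
  constructor
  · intro x y hxy
    obtain ⟨f, rfl⟩ := P.extOfCocycle_surjective i M x
    obtain ⟨g, rfl⟩ := P.extOfCocycle_surjective i M y
    rw [extBaseChange_extOfCocycle, extBaseChange_extOfCocycle] at hxy
    rw [← sub_eq_zero, ← map_sub, ProjectiveResolution.extOfCocycle_eq_zero_iff] at hxy ⊢
    obtain ⟨k, hk⟩ := hxy
    obtain ⟨z, hz⟩ := IsBaseChange.exists_eq_of_exists_map_eq θ (hw _) (hw i) (hc i _) hq
      (x := (f - g).1.hom) congr(Hom.hom $((f - g).2)) (y := k.hom)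
      (congr(Hom.hom $hk).trans congr(Hom.hom $(baseChangeHom_sub u f.1 g.1)).symm)
    exact ⟨ofHom z, hom_ext hz⟩
  · intro y
    obtain ⟨g, rfl⟩ := (baseChangeResolution P a).extOfCocycle_surjective i M' y
    obtain ⟨x, hx, z, hz⟩ := IsBaseChange.exists_sub_eq θ hθ (hw i) (hw (i + 1)) (hc i _)
      (hc (i + 1) i) hq (y := g.1.hom) congr(Hom.hom $(g.2))
    refine ⟨P.extOfCocycle R i M ⟨ofHom x, hom_ext hx⟩, ?_⟩
    rw [extBaseChange_extOfCocycle, eq_comm, ← sub_eq_zero, ← map_sub,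
      ProjectiveResolution.extOfCocycle_eq_zero_iff]
    exact ⟨ofHom z, hom_ext hz⟩

lemma map_extBaseChange (P : ProjectiveResolution N) (a : (baseChange R S).obj N ≅ N')
    (u : M →ₗ[R] M') (u₂ : M₂ →ₗ[R] M₂') (b : M ⟶ M₂) (b' : M' ⟶ M₂')
    (h : ∀ x, b' (u x) = u₂ (b x)) (i : ℕ)
    (x : ((Ext R (ModuleCat.{u} R) i).obj (op N)).obj M) :
    ((Ext S (ModuleCat.{u} S) i).obj (op N')).map b' (extBaseChange P a u i x) =
      extBaseChange P a u₂ i (((Ext R (ModuleCat.{u} R) i).obj (op N)).map b x) := by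
  obtain ⟨f, rfl⟩ := P.extOfCocycle_surjective i M x
  rw [extBaseChange_extOfCocycle, ProjectiveResolution.map_extOfCocycle,
    ProjectiveResolution.map_extOfCocycle, extBaseChange_extOfCocycle]
  exact congrArg _ (Subtype.ext (baseChangeHom_comp u u₂ b b' h f.1))

/-- A lift of c to the resolutions base changes to a lift of c', so one cocycle represents both
sides. -/
lemma map_op_extBaseChange (P : ProjectiveResolution N) (a : (baseChange R S).obj N ≅ N')
    (P₂ : ProjectiveResolution N₂) (a₂ : (baseChange R S).obj N₂ ≅ N₂')
    (c : N₂ ⟶ N) (c' : N₂' ⟶ N') (hc : (baseChange R S).map c ≫ a.hom = a₂.hom ≫ c')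
    (u : M →ₗ[R] M') (i : ℕ) (x : ((Ext R (ModuleCat.{u} R) i).obj (op N)).obj M) :
    ((Ext S (ModuleCat.{u} S) i).map c'.op).app M' (extBaseChange P a u i x) =
      extBaseChange P₂ a₂ u i (((Ext R (ModuleCat.{u} R) i).map c.op).app M x) := by
  obtain ⟨f, rfl⟩ := P.extOfCocycle_surjective i M x
  let φ := ProjectiveResolution.lift c P₂ P
  have hφ : φ.f 0 ≫ P.π.f 0 = P₂.π.f 0 ≫ c := ProjectiveResolution.lift_commutes_zero c P₂ P
  let φ' : (baseChangeResolution P₂ a₂).complex ⟶ (baseChangeResolution P a).complex :=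
    ((baseChange R S).mapHomologicalComplex _).map φ
  have hφ' : φ'.f 0 ≫ (baseChangeResolution P a).π.f 0 =
      (baseChangeResolution P₂ a₂).π.f 0 ≫ c' := by
    have h (π : P.complex.X 0 ⟶ N) (π₂ : P₂.complex.X 0 ⟶ N₂) (h : φ.f 0 ≫ π = π₂ ≫ c) :
        (baseChange R S).map (φ.f 0) ≫ (baseChange R S).map π ≫ a.hom =
          ((baseChange R S).map π₂ ≫ a₂.hom) ≫ c' := by
      rw [← Functor.map_comp_assoc, h, Functor.map_comp, Category.assoc, hc, Category.assoc]
    rw [baseChangeResolution_π_f_zero, baseChangeResolution_π_f_zero]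
    exact h _ _ hφ
  rw [extBaseChange_extOfCocycle, ProjectiveResolution.map_op_extOfCocycle _ _ _ φ hφ,
    ProjectiveResolution.map_op_extOfCocycle _ _ _ φ' hφ', extBaseChange_extOfCocycle]
  exact congrArg _ (Subtype.ext (baseChange_map_comp_baseChangeHom u _ f.1))

end ModuleCat

end

/-! ### Local cohomology as a colimit of Ext, and its base change -/

noncomputable section

open TensorProduct

namespace localCohomology

section

variable {R : Type u} [CommRing R] (J : Ideal R)

/-- The module `R/J^n`. -/
abbrev powQuot (n : ℕ) : ModuleCat.{u} R := (ringModIdeals (idealPowersDiagram J)).obj (op n)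

/-- The projection `R/J^k ⟶ R/J^n`. -/
abbrev powQuotMap {n k : ℕ} (h : n ≤ k) : powQuot J k ⟶ powQuot J n :=
  (ringModIdeals (idealPowersDiagram J)).map (homOfLE h).op

/-- The canonical map from `Ext^i(R/J^n, M)` to local cohomology. -/
def ofExt (i n : ℕ) (M : ModuleCat.{u} R) :
    ((Ext R (ModuleCat.{u} R) i).obj (op (powQuot J n))).obj M ⟶ (localCohomology J i).obj M :=
  (colimit.ι (diagram (idealPowersDiagram J) i) (op (op n))).app M

lemma map_ofExt (i n : ℕ) {M M₂ : ModuleCat.{u} R} (b : M ⟶ M₂)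
    (x : ((Ext R (ModuleCat.{u} R) i).obj (op (powQuot J n))).obj M) :
    (localCohomology J i).map b (ofExt J i n M x) =
      ofExt J i n M₂ (((Ext R (ModuleCat.{u} R) i).obj (op (powQuot J n))).map b x) :=
  congr($((colimit.ι (diagram (idealPowersDiagram J) i) (op (op n))).naturality b) x).symm

/-- Local cohomology of `M` as a colimit of modules. -/
def isColimitOfExt (i : ℕ) (M : ModuleCat.{u} R) :
    IsColimit (((evaluation _ _).obj M).mapCocone
      (colimit.cocone (diagram (idealPowersDiagram J) i))) :=
  isColimitOfPreserves ((evaluation _ _).obj M) (colimit.isColimit _)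

/-- The colimit over powers of J is filtered, hence computed on underlying sets; elements and
equalities then come from a finite stage. -/
instance : PreservesColimitsOfShape ℕᵒᵖᵒᵖ (forget (ModuleCat.{u} R)) :=
  have := preservesFilteredColimitsOfSize_shrink.{0, u, 0, u} (forget (ModuleCat.{u} R))
  PreservesFilteredColimitsOfSize.preserves_filtered_colimits _

lemma exists_ofExt_eq (i : ℕ) (M : ModuleCat.{u} R) (x : (localCohomology J i).obj M) :
    ∃ n y, ofExt J i n M y = x := by
  obtain ⟨j, y, h⟩ := Concrete.isColimit_exists_rep _ (isColimitOfExt J i M) x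
  exact ⟨j.unop.unop, y, h⟩

lemma ofExt_eq_iff (i : ℕ) (M : ModuleCat.{u} R) {n m : ℕ}
    (x : ((Ext R (ModuleCat.{u} R) i).obj (op (powQuot J n))).obj M)
    (y : ((Ext R (ModuleCat.{u} R) i).obj (op (powQuot J m))).obj M) :
    ofExt J i n M x = ofExt J i m M y ↔ ∃ (k : ℕ) (hn : n ≤ k) (hm : m ≤ k),
      ((Ext R (ModuleCat.{u} R) i).map (powQuotMap J hn).op).app M x =
        ((Ext R (ModuleCat.{u} R) i).map (powQuotMap J hm).op).app M y := by
  refine (Concrete.isColimit_rep_eq_iff_exists _ (isColimitOfExt J i M) x y).trans ?_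
  constructor
  · rintro ⟨k, f, g, h⟩
    exact ⟨k.unop.unop, leOfHom f.unop.unop, leOfHom g.unop.unop, h⟩
  · rintro ⟨k, hn, hm, h⟩
    exact ⟨op (op k), (homOfLE hn).op.op, (homOfLE hm).op.op, h⟩

end

section

variable {R S : Type u} [CommRing R] [CommRing S] [Algebra R S]

/-- `S ⊗ R/K ≅ S/KS`. -/
def baseChangeQuotIso (K : Ideal R) (L : Ideal S) (h : L = K.map (algebraMap R S)) :
    S ⊗[R] (R ⧸ K) ≃ₗ[S] S ⧸ L :=
  (Algebra.TensorProduct.quotIdealMapEquivTensorQuot S K).symm.toLinearEquiv ≪≫ₗ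
    Submodule.quotEquivOfEq _ _ h.symm

lemma baseChangeQuotIso_one_tmul_mk (K : Ideal R) (L : Ideal S) (h : L = K.map (algebraMap R S))
    (r : R) : baseChangeQuotIso K L h (1 ⊗ₜ[R] Ideal.Quotient.mk K r) =
      Ideal.Quotient.mk L (algebraMap R S r) := by
  subst h
  rw [Algebra.algebraMap_eq_smul_one]
  exact congrArg (Submodule.quotEquivOfEq _ _ rfl)
    (Algebra.TensorProduct.quotIdealMapEquivTensorQuot_symm_tmul S K 1 r)

variable (S) (J : Ideal R)

/-- `S ⊗ R/J^n ≅ S/(JS)^n`. -/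
def baseChangePowQuot (n : ℕ) : (ModuleCat.baseChange R S).obj (powQuot J n) ≅
    powQuot (J.map (algebraMap R S)) n :=
  (baseChangeQuotIso (J ^ n) (J.map (algebraMap R S) ^ n) (Ideal.map_pow _ _ _).symm).toModuleIso

lemma baseChangePowQuot_naturality {n k : ℕ} (h : n ≤ k) :
    (ModuleCat.baseChange R S).map (powQuotMap J h) ≫ (baseChangePowQuot S J n).hom =
      (baseChangePowQuot S J k).hom ≫ powQuotMap (J.map (algebraMap R S)) h := by
  refine ModuleCat.baseChange_obj_hom_ext fun x ↦ ?_
  obtain ⟨r, rfl⟩ := Ideal.Quotient.mk_surjective x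
  exact (baseChangeQuotIso_one_tmul_mk (J ^ n) (J.map (algebraMap R S) ^ n)
    (Ideal.map_pow _ _ _).symm r).trans
    (congrArg (powQuotMap (J.map (algebraMap R S)) h) (baseChangeQuotIso_one_tmul_mk (J ^ k)
      (J.map (algebraMap R S) ^ k) (Ideal.map_pow _ _ _).symm r)).symm

variable [Module.Flat R S]
variable {M M₂ : ModuleCat.{u} R} {M' M₂' : ModuleCat.{u} S}
  [Module R M'] [IsScalarTower R S M'] [Module R M₂'] [IsScalarTower R S M₂']
variable (u : M →ₗ[R] M') (i : ℕ)

/-- The map on `Ext^i(R/J^n, -)` induced by base change. -/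
abbrev extPowBaseChange (n : ℕ)
    (x : ((Ext R (ModuleCat.{u} R) i).obj (op (powQuot J n))).obj M) :
    ((Ext S (ModuleCat.{u} S) i).obj (op (powQuot (J.map (algebraMap R S)) n))).obj M' :=
  ModuleCat.extBaseChange (ModuleCat.freeResolution (powQuot J n)) (baseChangePowQuot S J n) u i x

lemma map_extPowBaseChange {n k : ℕ} (h : n ≤ k)
    (x : ((Ext R (ModuleCat.{u} R) i).obj (op (powQuot J n))).obj M) :
    ((Ext S (ModuleCat.{u} S) i).map (powQuotMap (J.map (algebraMap R S)) h).op).app M'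
      (extPowBaseChange S J u i n x) =
      extPowBaseChange S J u i k (((Ext R (ModuleCat.{u} R) i).map (powQuotMap J h).op).app M x) :=
  ModuleCat.map_op_extBaseChange _ _ _ _ _ _ (baseChangePowQuot_naturality S J h) u i x

/-- The map on local cohomology induced by an `R`-linear map `M → M'`. -/
def localCohomologyBaseChange (x : (localCohomology J i).obj M) :
    (localCohomology (J.map (algebraMap R S)) i).obj M' :=
  ofExt _ i _ M' (extPowBaseChange S J u i _ (exists_ofExt_eq J i M x).choose_spec.choose)

/-- Two representatives agree at a later stage k, and base change commutes with the transition maps,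
so the choice is harmless. -/
lemma localCohomologyBaseChange_ofExt (n : ℕ)
    (x : ((Ext R (ModuleCat.{u} R) i).obj (op (powQuot J n))).obj M) :
    localCohomologyBaseChange S J u i (ofExt J i n M x) =
      ofExt _ i n M' (extPowBaseChange S J u i n x) := by
  have h := (exists_ofExt_eq J i M (ofExt J i n M x)).choose_spec.choose_spec
  rw [ofExt_eq_iff] at h
  obtain ⟨k, h₁, h₂, h⟩ := h
  refine (ofExt_eq_iff _ _ _ _ _).2 ⟨k, h₁, h₂, ?_⟩
  rw [map_extPowBaseChange, map_extPowBaseChange, h]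

lemma map_localCohomologyBaseChange (u₂ : M₂ →ₗ[R] M₂') (b : M ⟶ M₂) (b' : M' ⟶ M₂')
    (h : ∀ x, b' (u x) = u₂ (b x)) (x : (localCohomology J i).obj M) :
    (localCohomology (J.map (algebraMap R S)) i).map b' (localCohomologyBaseChange S J u i x) =
      localCohomologyBaseChange S J u₂ i ((localCohomology J i).map b x) := by
  obtain ⟨n, x, rfl⟩ := exists_ofExt_eq J i M x
  rw [localCohomologyBaseChange_ofExt, map_ofExt, map_ofExt, localCohomologyBaseChange_ofExt,
    ModuleCat.map_extBaseChange _ _ u u₂ b b' h]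

/-- Local cohomology is invariant under flat base change along which the quotients `R/J^n` do not
change. -/
lemma localCohomologyBaseChange_bijective [IsNoetherianRing R]
    (θ : ∀ n, S →ₐ[R] R ⧸ J ^ n) (hθ : ∀ n, RingHom.ker (θ n) ≤ (J ^ n).map (algebraMap R S))
    (hu : IsBaseChange S u) :
    Function.Bijective (localCohomologyBaseChange S J u i) := by
  have hE (n : ℕ) : Function.Bijective (extPowBaseChange S J u i n) := by
    have : Module.Finite R (powQuot J n) := inferInstanceAs (Module.Finite R (R ⧸ J ^ n))
    refine ModuleCat.extBaseChange_bijective _ _ (q := J ^ n) (fun r hr x ↦ ?_) (θ n) (hθ n) hu i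
    obtain ⟨s, rfl⟩ := Ideal.Quotient.mk_surjective x
    exact Ideal.Quotient.eq_zero_iff_mem.2 ((J ^ n).mul_mem_right s hr)
  constructor
  · intro x y hxy
    obtain ⟨n, x, rfl⟩ := exists_ofExt_eq J i M x
    obtain ⟨m, y, rfl⟩ := exists_ofExt_eq J i M y
    rw [localCohomologyBaseChange_ofExt, localCohomologyBaseChange_ofExt, ofExt_eq_iff] at hxy
    obtain ⟨k, h₁, h₂, h⟩ := hxy
    rw [map_extPowBaseChange, map_extPowBaseChange] at h
    exact (ofExt_eq_iff _ _ _ _ _).2 ⟨k, h₁, h₂, (hE k).1 h⟩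
  · intro y
    obtain ⟨n, y, rfl⟩ := exists_ofExt_eq _ i M' y
    obtain ⟨x, rfl⟩ := (hE n).2 y
    exact ⟨_, localCohomologyBaseChange_ofExt S J u i n x⟩

end

end localCohomology

/-! ### Transfer of surjectivity of the limit projections -/

section Transfer

lemma ModuleCat.epi_limit_π_iff {R : Type u} [CommRing R] (F : ℕᵒᵖ ⥤ ModuleCat.{u} R) (s : ℕᵒᵖ) :
    Epi (limit.π F s) ↔ ∀ x : F.obj s, ∃ y : ∀ t, F.obj t,
      (∀ {t t'} (f : t ⟶ t'), F.map f (y t) = y t') ∧ y s = x := by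
  let e := Types.isLimitEquivSections
    (isLimitOfPreserves (forget (ModuleCat.{u} R)) (limit.isLimit F))
  have he (y t) : (e y).1 t = limit.π F t y := rfl
  rw [ModuleCat.epi_iff_surjective]
  refine forall_congr' fun x ↦ ⟨fun ⟨y, hy⟩ ↦ ⟨(e y).1, fun f ↦ (e y).2 f, hy⟩,
    fun ⟨y, hy, hx⟩ ↦ ⟨e.symm ⟨y, fun f ↦ hy f⟩, ?_⟩⟩
  rw [← he, Equiv.apply_symm_apply]
  exact hx

/-- Surjectivity only concerns compatible families of elements, so bijections of sets suffice: no
linearity is needed, and the base rings may differ. -/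
lemma ModuleCat.epi_limit_π_iff_of_bijective {R S : Type u} [CommRing R] [CommRing S]
    {F : ℕᵒᵖ ⥤ ModuleCat.{u} R} {G : ℕᵒᵖ ⥤ ModuleCat.{u} S} (E : ∀ t, F.obj t → G.obj t)
    (hE : ∀ t, Function.Bijective (E t))
    (h : ∀ {t t'} (f : t ⟶ t') (x : F.obj t), G.map f (E t x) = E t' (F.map f x)) (s : ℕᵒᵖ) :
    Epi (limit.π F s) ↔ Epi (limit.π G s) := by
  rw [ModuleCat.epi_limit_π_iff, ModuleCat.epi_limit_π_iff, (hE _).2.forall]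
  refine forall_congr' fun x ↦ ⟨fun ⟨y, hy, hx⟩ ↦ ⟨fun t ↦ E t (y t), fun f ↦ ?_, congrArg _ hx⟩,
    fun ⟨y, hy, hx⟩ ↦ ?_⟩
  · rw [h, hy]
  · choose z hz using fun t ↦ (hE t).2 (y t)
    refine ⟨z, fun f ↦ (hE _).1 ?_, (hE _).1 ((hz _).trans hx)⟩
    rw [← h, hz, hz, hy]

lemma localCohomology.epi_limit_π_iff {R S : Type u} [CommRing R] [CommRing S] [Algebra R S]
    [IsNoetherianRing R] [Module.Flat R S] (𝔪 : Ideal R)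
    (θ : ∀ n, S →ₐ[R] R ⧸ 𝔪 ^ n) (hθ : ∀ n, RingHom.ker (θ n) ≤ (𝔪 ^ n).map (algebraMap R S))
    (A : ℕᵒᵖ ⥤ ModuleCat.{u} R) (B : ℕᵒᵖ ⥤ ModuleCat.{u} S)
    [∀ t, Module R (B.obj t)] [∀ t, IsScalarTower R S (B.obj t)]
    (w : ∀ t, A.obj t →ₗ[R] B.obj t) (hw : ∀ t, IsBaseChange S (w t))
    (h : ∀ {t t'} (f : t ⟶ t') (x : A.obj t), B.map f (w t x) = w t' (A.map f x))
    (i : ℕ) (s : ℕᵒᵖ) :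
    Epi (limit.π (A ⋙ localCohomology 𝔪 i) s) ↔
      Epi (limit.π (B ⋙ localCohomology (𝔪.map (algebraMap R S)) i) s) :=
  ModuleCat.epi_limit_π_iff_of_bijective
    (F := A ⋙ localCohomology 𝔪 i) (G := B ⋙ localCohomology (𝔪.map (algebraMap R S)) i)
    (fun t ↦ localCohomologyBaseChange S 𝔪 (w t) i)
    (fun t ↦ localCohomologyBaseChange_bijective S 𝔪 _ i θ hθ (hw t))
    (fun f x ↦ map_localCohomologyBaseChange S 𝔪 _ i _ (A.map f) (B.map f) (h f) x) s

/-- Transfer of the cohomological Mittag-Leffler condition along a flat ring map inducing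
isomorphisms modulo all powers of `𝔪`. -/
lemma IsCofinalFlatTriple.isCML_iff {R S : Type u} [CommRing R] [CommRing S] [Algebra R S]
    [IsNoetherianRing R] [Module.Flat R S] {I : Ideal R} {φ : R →+* R}
    (h : IsCofinalFlatTriple I φ) {J : Ideal S} {ψ : S →+* S} (h' : IsCofinalFlatTriple J ψ)
    (hJ : ∀ t : ℕ, J.map (ψ ^ t) = (I.map (φ ^ t)).map (algebraMap R S)) (𝔪 : Ideal R)
    (θ : ∀ n, S →ₐ[R] R ⧸ 𝔪 ^ n) (hθ : ∀ n, RingHom.ker (θ n) ≤ (𝔪 ^ n).map (algebraMap R S)) :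
    h.IsCML 𝔪 ↔ h'.IsCML (𝔪.map (algebraMap R S)) := by
  let w (t : ℕᵒᵖ) : (R ⧸ I.map (φ ^ t.unop)) →ₗ[R] (S ⧸ J.map (ψ ^ t.unop)) :=
    (localCohomology.baseChangeQuotIso _ _ (hJ t.unop)).restrictScalars R ∘ₗ
      TensorProduct.mk R S (R ⧸ I.map (φ ^ t.unop)) 1
  have hw (t : ℕᵒᵖ) : IsBaseChange S (w t) := IsBaseChange.of_equiv
    (localCohomology.baseChangeQuotIso _ _ (hJ t.unop)) fun _ ↦ rfl
  have hw' (t : ℕᵒᵖ) (r : R) : w t (Ideal.Quotient.mk _ r) =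
      Ideal.Quotient.mk _ (algebraMap R S r) :=
    localCohomology.baseChangeQuotIso_one_tmul_mk _ _ (hJ t.unop) r
  let (t : ℕᵒᵖ) : Module R ((localCohomology.ringModIdeals h'.chain).obj t) :=
    inferInstanceAs (Module R (S ⧸ J.map (ψ ^ t.unop)))
  have (t : ℕᵒᵖ) : IsScalarTower R S ((localCohomology.ringModIdeals h'.chain).obj t) :=
    inferInstanceAs (IsScalarTower R S (S ⧸ J.map (ψ ^ t.unop)))
  refine forall_congr' fun i ↦ forall_congr' fun s ↦ ?_
  refine localCohomology.epi_limit_π_iff 𝔪 θ hθ (localCohomology.ringModIdeals h.chain)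
    (localCohomology.ringModIdeals h'.chain) w hw (fun {t t'} f x ↦ ?_) i (op s)
  obtain ⟨r, rfl⟩ := Ideal.Quotient.mk_surjective x
  exact (congrArg ((localCohomology.ringModIdeals h'.chain).map f) (hw' t r)).trans (hw' t' r).symm

end Transfer

end

/-! ### A local criterion of flatness -/

section Flatness

open TensorProduct

variable {R S B : Type*} [CommRing R] [CommRing S] [CommRing B] [Algebra R S] [Algebra S B]
  [Algebra R B] [IsScalarTower R S B]

lemma exists_sub_algebraMap_mem {q : Ideal R} (θ : S →ₐ[R] R ⧸ q)
    (hθ : RingHom.ker θ ≤ q.map (algebraMap R S)) (s : S) :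
    ∃ r, s - algebraMap R S r ∈ q.map (algebraMap R S) := by
  obtain ⟨r, hr⟩ := Ideal.Quotient.mk_surjective (θ s)
  refine ⟨r, hθ ?_⟩
  rw [RingHom.mem_ker, map_sub, AlgHom.commutes, ← hr]
  exact sub_self _

/-- If `R/q = S/qS`, then `B ⊗_R Q = B ⊗_S Q` for modules `Q` killed by `q`. -/
lemma compatibleSMul_of_smul_eq_zero {q : Ideal R} (θ : S →ₐ[R] R ⧸ q)
    (hθ : RingHom.ker θ ≤ q.map (algebraMap R S)) (Q : Type*) [AddCommGroup Q] [Module R Q]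
    [Module S Q] [IsScalarTower R S Q] (hQ : ∀ r ∈ q, ∀ x : Q, r • x = 0) :
    TensorProduct.CompatibleSMul R S B Q where
  smul_tmul s b x := by
    have h (t : S) (ht : t ∈ q.map (algebraMap R S)) :
        (∀ b : B, (t • b) ⊗ₜ[R] x = 0) ∧ t • x = 0 := by
      induction ht using Submodule.span_induction with
      | mem t ht =>
        obtain ⟨r, hr, rfl⟩ := ht
        exact ⟨fun b ↦ by rw [algebraMap_smul, TensorProduct.smul_tmul, hQ r hr, tmul_zero],
          by rw [algebraMap_smul, hQ r hr]⟩
      | zero => simp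
      | add t t' _ _ h h' =>
        exact ⟨fun b ↦ by rw [add_smul, add_tmul, h.1, h'.1, add_zero],
          by rw [add_smul, h.2, h'.2, add_zero]⟩
      | smul s t _ h =>
        exact ⟨fun b ↦ by rw [smul_assoc, smul_comm]; exact h.1 _,
          by rw [smul_assoc, h.2, smul_zero]⟩
    obtain ⟨r, hr⟩ := exists_sub_algebraMap_mem θ hθ s
    obtain ⟨h₁, h₂⟩ := h _ hr
    have h₁ := h₁ b
    rw [sub_smul, sub_tmul, sub_eq_zero, algebraMap_smul] at h₁
    rw [sub_smul, sub_eq_zero, algebraMap_smul] at h₂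
    rw [h₁, h₂, TensorProduct.smul_tmul]

/-- On modules killed by q, tensoring with B over S is tensoring over R, where B is flat. -/
lemma lTensor_injective_of_smul_eq_zero [Module.Flat R B] {q : Ideal R} (θ : S →ₐ[R] R ⧸ q)
    (hθ : RingHom.ker θ ≤ q.map (algebraMap R S)) {Q Q' : Type*} [AddCommGroup Q] [Module R Q]
    [Module S Q] [IsScalarTower R S Q] (hQ : ∀ r ∈ q, ∀ x : Q, r • x = 0)
    [AddCommGroup Q'] [Module R Q'] [Module S Q'] [IsScalarTower R S Q']
    (hQ' : ∀ r ∈ q, ∀ x : Q', r • x = 0) (f : Q →ₗ[S] Q') (hf : Function.Injective f) :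
    Function.Injective (f.lTensor B) := by
  have := compatibleSMul_of_smul_eq_zero (B := B) θ hθ Q hQ
  have := compatibleSMul_of_smul_eq_zero (B := B) θ hθ Q' hQ'
  have h₁ : Function.Injective (mapOfCompatibleSMul R S R B Q) :=
    (equivOfCompatibleSMul R S R B Q).injective
  have h₂ := Module.Flat.lTensor_preserves_injective_linearMap (M := B) (f.restrictScalars R) hf
  have h (x : B ⊗[S] Q) : (f.restrictScalars R).lTensor B (mapOfCompatibleSMul R S R B Q x) =
      mapOfCompatibleSMul R S R B Q' (f.lTensor B x) := by
    induction x with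
    | zero => simp
    | tmul => rfl
    | add x y hx hy => rw [map_add, map_add, map_add, map_add, hx, hy]
  intro x y hxy
  exact h₁ (h₂ (by rw [h, h, hxy]))

lemma mem_smul_top_of_mem_range_lTensor {M : Type*} [AddCommGroup M] [Module S M] (K : Ideal S)
    (N : Submodule S M) (hN : N ≤ K • ⊤) (x : B ⊗[S] N) :
    N.subtype.lTensor B x ∈ (K.map (algebraMap S B) • ⊤ : Submodule B (B ⊗[S] M)) := by
  induction x with
  | zero => simp
  | add x y hx hy => rw [map_add]; exact add_mem hx hy
  | tmul b y =>
    rw [LinearMap.lTensor_tmul]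
    refine Submodule.smul_induction_on (p := fun z ↦ b ⊗ₜ[S] z ∈
      (K.map (algebraMap S B) • ⊤ : Submodule B (B ⊗[S] M))) (hN y.2) (fun s hs m _ ↦ ?_)
      fun z z' hz hz' ↦ ?_
    · rw [tmul_smul, ← algebraMap_smul B s]
      exact Submodule.smul_mem_smul (Ideal.mem_map_of_mem _ hs) trivial
    · rw [tmul_add]
      exact add_mem hz hz'

/-- A form of the local criterion of flatness: if `R/𝔞^n = S/𝔞^nS` for all `n`, then `B` is
flat over `S` as soon as it is flat over `R`. -/
lemma Module.Flat.of_forall_algHom_quotient_pow [IsNoetherianRing S] [IsNoetherianRing B]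
    [Module.Flat R B] (𝔞 : Ideal R) (θ : ∀ n, S →ₐ[R] R ⧸ 𝔞 ^ n)
    (hθ : ∀ n, RingHom.ker (θ n) ≤ (𝔞 ^ n).map (algebraMap R S))
    (hB : 𝔞.map (algebraMap R B) ≤ Ideal.jacobson ⊥) : Module.Flat S B := by
  rw [Module.Flat.iff_lTensor_injective]
  intro J hJ
  have : Module.Finite S J := Module.Finite.iff_fg.2 hJ
  -- B ⊗ J is finite over the Noetherian ring B, hence 𝔞-adically separated by Krull; it suffices to
  -- put a kernel element x into 𝔞^n(B ⊗ J) for every n.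
  have := IsHausdorff.of_le_jacobson _ (B ⊗[S] J) hB
  rw [injective_iff_map_eq_zero]
  intro x hx
  refine IsHausdorff.haus this x fun n ↦ SModEq.zero.2 ?_
  -- Artin–Rees: 𝔞^(n+k)S ∩ J lies in 𝔞^n J, which dictates the exponent n + k.
  obtain ⟨k, hk⟩ := (𝔞.map (algebraMap R S)).exists_pow_inf_eq_pow_smul J
  let K : Ideal S := (𝔞 ^ (n + k)).map (algebraMap R S)
  let J₀ : Submodule S J := Submodule.comap J.subtype K
  have hJ₀ : J₀ ≤ (𝔞.map (algebraMap R S)) ^ n • ⊤ := by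
    intro y hy
    have h1 : (y : S) ∈ (𝔞.map (algebraMap R S)) ^ (n + k) • (⊤ : Ideal S) ⊓ J := by
      refine ⟨?_, y.2⟩
      rw [← Ideal.map_pow, smul_eq_mul, Ideal.mul_top]
      exact hy
    rw [hk _ (Nat.le_add_left k n), Nat.add_sub_cancel] at h1
    have h2 : (y : S) ∈ (𝔞.map (algebraMap R S)) ^ n • J :=
      Submodule.smul_mono le_rfl inf_le_right h1
    have h3 : (𝔞.map (algebraMap R S)) ^ n • J =
        ((𝔞.map (algebraMap R S)) ^ n • (⊤ : Submodule S J)).map J.subtype := by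
      rw [Submodule.map_smul'', Submodule.map_top, Submodule.range_subtype]
    rw [h3] at h2
    obtain ⟨z, hz, hzy⟩ := h2
    rwa [← Subtype.ext hzy]
  have hinj : Function.Injective (J₀.mapQ K J.subtype le_rfl) := by
    rw [← LinearMap.ker_eq_bot, Submodule.ker_mapQ]
    exact (Submodule.map_le_iff_le_comap.2
      (by rw [Submodule.comap_bot, Submodule.ker_mkQ])).antisymm bot_le
  have hK : ∀ r ∈ 𝔞 ^ (n + k), algebraMap R S r ∈ K := fun r hr ↦ Ideal.mem_map_of_mem _ hr
  have hinj' := lTensor_injective_of_smul_eq_zero (B := B) (θ (n + k)) (hθ _)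
    (fun r hr z ↦ by
      obtain ⟨z, rfl⟩ := Submodule.mkQ_surjective _ z
      rw [← algebraMap_smul S r, ← map_smul, Submodule.mkQ_apply, Submodule.Quotient.mk_eq_zero]
      exact K.mul_mem_right (z : S) (hK r hr))
    (fun r hr z ↦ by
      obtain ⟨z, rfl⟩ := Submodule.mkQ_surjective _ z
      rw [← algebraMap_smul S r, ← map_smul, Submodule.mkQ_apply, Submodule.Quotient.mk_eq_zero]
      exact K.mul_mem_right z (hK r hr)) _ hinj
  -- J/J₀ → S/K is injective between modules killed by 𝔞^(n+k), so it stays injective after B ⊗ -.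
  -- Thus x dies in B ⊗ J/J₀ and comes from B ⊗ J₀, whose image lies in 𝔞^n(B ⊗ J).
  have h0 : J₀.mkQ.lTensor B x = 0 := by
    apply hinj'
    rw [map_zero, ← LinearMap.comp_apply, ← LinearMap.lTensor_comp, show J₀.mapQ K J.subtype le_rfl ∘ₗ J₀.mkQ = K.mkQ ∘ₗ J.subtype from rfl,
      LinearMap.lTensor_comp, LinearMap.comp_apply]
    exact (congrArg _ hx).trans (map_zero _)
  obtain ⟨y, rfl⟩ := (_root_.lTensor_exact B (LinearMap.exact_subtype_mkQ J₀)
    J₀.mkQ_surjective x).1 h0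
  have := mem_smul_top_of_mem_range_lTensor _ J₀ hJ₀ y
  rwa [Ideal.map_pow, Ideal.map_map, ← IsScalarTower.algebraMap_eq] at this

end Flatness

/-! ### Completions: quotients, Noetherianity, regularity -/

namespace AdicCompletion

variable {R : Type*} [CommRing R]

lemma ker_evalₐ_le (I : Ideal R) (h : I.FG) (n : ℕ) :
    RingHom.ker (evalₐ I n) ≤ (I ^ n).map (algebraMap R (AdicCompletion I R)) := by
  intro x hx
  have hx' : x ∈ (eval I R n).ker := by
    rw [LinearMap.mem_ker, ← factor_evalₐ_eq_eval I x (by simp), RingHom.mem_ker.1 hx]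
    exact (Ideal.Quotient.factor _).map_zero
  rw [← pow_smul_top_eq_ker_eval h, Ideal.smul_top_eq_map] at hx'
  exact hx'

lemma ker_evalₐ (I : Ideal R) (h : I.FG) (n : ℕ) :
    RingHom.ker (evalₐ I n) = (I ^ n).map (algebraMap R (AdicCompletion I R)) := by
  refine (ker_evalₐ_le I h n).antisymm (Ideal.map_le_iff_le_comap.2 fun r hr ↦ ?_)
  rw [Ideal.mem_comap, RingHom.mem_ker, AlgHom.commutes]
  exact Ideal.Quotient.eq_zero_iff_mem.2 hr

lemma factorPow_comp_quotientMap_comp_evalₐ {A : Type*} [CommRing A] {J : Ideal A} {I : Ideal R}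
    (f : A →+* R) (hf : ∀ n, J ^ n ≤ (I ^ n).comap f) {m n : ℕ} (hle : m ≤ n) :
    (Ideal.Quotient.factorPow I hle).comp ((Ideal.quotientMap (I ^ n) f (hf n)).comp
      (evalₐ J n : AdicCompletion J A →+* A ⧸ J ^ n)) =
    (Ideal.quotientMap (I ^ m) f (hf m)).comp (evalₐ J m : AdicCompletion J A →+* A ⧸ J ^ m) := by
  ext x
  obtain ⟨y, rfl⟩ := mk_surjective J A x
  have h := Ideal.mk_eq_mk J hle y
  simp [evalₐ_mk, ← h]

/-- The map on completions induced by a ring map `f` with `f(J) ⊆ I`. -/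
noncomputable def mapRingHom {A : Type*} [CommRing A] {J : Ideal A} {I : Ideal R} (f : A →+* R)
    (hf : J ≤ I.comap f) : AdicCompletion J A →+* AdicCompletion I R :=
  liftRingHom I _ (factorPow_comp_quotientMap_comp_evalₐ f fun n ↦
    (Ideal.pow_right_mono hf n).trans (Ideal.le_comap_pow f n))

lemma mapRingHom_algebraMap {A : Type*} [CommRing A] {J : Ideal A} {I : Ideal R} (f : A →+* R)
    (hf : J ≤ I.comap f) (a : A) : mapRingHom f hf (algebraMap A _ a) = algebraMap R _ (f a) := by
  refine ext_evalₐ fun n ↦ (evalₐ_liftRingHom I _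
    (factorPow_comp_quotientMap_comp_evalₐ f _) n _).trans ?_
  rw [AlgHom.commutes]
  exact congrArg (Ideal.quotientMap (I ^ n) f
    ((Ideal.pow_right_mono hf n).trans (Ideal.le_comap_pow f n))) (AlgHom.commutes (evalₐ J n) a)

/-- The source is adically complete and the target separated, so surjectivity modulo J suffices;
there it follows from that of f. -/
lemma mapRingHom_surjective {A : Type*} [CommRing A] {J : Ideal A} {I : Ideal R} (hJ : J.FG)
    (f : A →+* R) (hf : J.map f = I) (hf' : Function.Surjective f) :
    Function.Surjective (mapRingHom f (Ideal.map_le_iff_le_comap.1 hf.le)) := by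
  have hI : I.FG := hf ▸ hJ.map f
  set F := mapRingHom f (Ideal.map_le_iff_le_comap.1 hf.le)
  have hF : (J.map (algebraMap A (AdicCompletion J A))).map F =
      I.map (algebraMap R (AdicCompletion I R)) := by
    have h : F.comp (algebraMap A (AdicCompletion J A)) =
        (algebraMap R (AdicCompletion I R)).comp f := 
      RingHom.ext (mapRingHom_algebraMap f (Ideal.map_le_iff_le_comap.1 hf.le))
    rw [Ideal.map_map, h, ← Ideal.map_map, hf]
  have := isAdicComplete_self J hJ
  have := isAdicComplete_self I hI
  have : IsHausdorff ((J.map (algebraMap A (AdicCompletion J A))).map F)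
    (AdicCompletion I R) := by rw [hF]; infer_instance
  refine surjective_of_mk_map_comp_surjective F (I := J.map (algebraMap A _)) fun y ↦ ?_
  obtain ⟨y, rfl⟩ := Ideal.Quotient.mk_surjective y
  obtain ⟨r, hr⟩ := Ideal.Quotient.mk_surjective (evalₐ I 1 y)
  obtain ⟨a, rfl⟩ := hf' r
  refine ⟨algebraMap A _ a, Ideal.Quotient.eq.2 ?_⟩
  have h := ker_evalₐ I hI 1
  rw [congrArg (Ideal.map _) (pow_one I)] at h
  rw [hF, mapRingHom_algebraMap, ← h, RingHom.mem_ker, map_sub, AlgHom.commutes, ← hr]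
  exact sub_self _

/-- With n generators of I, the completion is a quotient of the Noetherian ring R[[X₁, …, Xₙ]]. -/
instance [IsNoetherianRing R] (I : Ideal R) : IsNoetherianRing (AdicCompletion I R) := by
  obtain ⟨n, g, hg⟩ := Submodule.fg_iff_exists_fin_generating_family.1
    (IsNoetherian.noetherian I)
  -- `R` is a quotient of `A = R[X₁, …, Xₙ]` by a map sending `(X₁, …, Xₙ)` onto `I`
  have hI : (MvPolynomial.idealOfVars (Fin n) R).map (MvPolynomial.aeval g).toRingHom = I := by
    rw [MvPolynomial.idealOfVars, Ideal.map_span, ← Set.range_comp, ← hg]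
    congr 2
    ext i
    simp
  have h := mapRingHom_surjective (MvPolynomial.idealOfVars_fg (Fin n) R) _ hI
    fun r ↦ ⟨MvPolynomial.C r, by simp⟩
  have := isNoetherianRing_of_ringEquiv _
    (MvPowerSeries.toAdicCompletionAlgEquiv (Fin n) R).toRingEquiv
  exact isNoetherianRing_of_surjective _ _ _ h

section

variable [IsNoetherianRing R] (𝔪 : Ideal R) [𝔪.IsMaximal]

lemma isMaximal_map : (𝔪.map (algebraMap R (AdicCompletion 𝔪 R))).IsMaximal :=
  isMaximal_map_of_le 𝔪 𝔪 le_rfl (IsNoetherian.noetherian 𝔪)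

lemma isLocalRing_of_isMaximal : IsLocalRing (AdicCompletion 𝔪 R) :=
  have := isMaximal_map 𝔪
  have := isAdicComplete_self 𝔪 (IsNoetherian.noetherian 𝔪)
  isLocalRing_of_isAdicComplete_maximal (𝔪.map (algebraMap R (AdicCompletion 𝔪 R)))

/-- The completion of a Noetherian ring at a maximal ideal `𝔪` generated by `ht 𝔪` elements is
regular. -/
lemma isRegularLocalRing_of_spanFinrank_le_height (h : 𝔪.spanFinrank ≤ 𝔪.height) :
    IsRegularLocalRing (AdicCompletion 𝔪 R) := by
  have := isMaximal_map 𝔪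
  have := isLocalRing_of_isMaximal 𝔪
  have hm := IsLocalRing.eq_maximalIdeal (isMaximal_map 𝔪)
  have : (IsLocalRing.maximalIdeal (AdicCompletion 𝔪 R)).LiesOver 𝔪 := by
    rw [← hm]
    refine ⟨(Ideal.IsMaximal.eq_of_le inferInstance ?_ Ideal.le_comap_map)⟩
    exact Ideal.comap_ne_top _ Ideal.IsPrime.ne_top'
  refine .of_spanFinrank_maximalIdeal_le _ ?_
  rw [← IsLocalRing.maximalIdeal_height_eq_ringKrullDim]
  norm_cast
  have h1 : (IsLocalRing.maximalIdeal (AdicCompletion 𝔪 R)).spanFinrank ≤ 𝔪.spanFinrank := by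
    rw [← hm]
    exact Ideal.spanFinrank_map_le_of_fg _ (IsNoetherian.noetherian 𝔪)
  calc ((IsLocalRing.maximalIdeal (AdicCompletion 𝔪 R)).spanFinrank : ℕ∞)
      ≤ 𝔪.spanFinrank := by exact_mod_cast h1
    _ ≤ 𝔪.height := h
    _ ≤ _ := by
      -- Flatness of the completion gives going-down, so heights cannot drop from 𝔪 to the maximal
      -- ideal above it.
      rw [Ideal.height_eq_height_add_of_liesOver_of_hasGoingDown 𝔪
        (IsLocalRing.maximalIdeal (AdicCompletion 𝔪 R))]
      exact le_self_add

end

end AdicCompletion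

/-! ### The induced endomorphism of the completion -/

section CompletionMap

variable {R : Type*} [CommRing R] {𝔪 : Ideal R} (φ : R →+* R) (hφ : 𝔪 ≤ 𝔪.comap φ)

lemma completionMap_comp_algebraMap :
    (completionMap φ hφ).comp (algebraMap R (AdicCompletion 𝔪 R)) =
      (algebraMap R (AdicCompletion 𝔪 R)).comp φ :=
  RingHom.ext (completionMap_algebraMap φ hφ)

lemma completionMap_pow_comp_algebraMap (t : ℕ) :
    (completionMap φ hφ ^ t).comp (algebraMap R (AdicCompletion 𝔪 R)) =
      (algebraMap R (AdicCompletion 𝔪 R)).comp (φ ^ t) := by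
  induction t with
  | zero => rfl
  | succ t ih =>
    rw [pow_succ, pow_succ, RingHom.mul_def, RingHom.mul_def, RingHom.comp_assoc,
      completionMap_comp_algebraMap, ← RingHom.comp_assoc, ih, RingHom.comp_assoc]

lemma map_map_completionMap_pow (I : Ideal R) (t : ℕ) :
    (I.map (algebraMap R (AdicCompletion 𝔪 R))).map (completionMap φ hφ ^ t) =
      (I.map (φ ^ t)).map (algebraMap R (AdicCompletion 𝔪 R)) := by
  rw [Ideal.map_map, Ideal.map_map, completionMap_pow_comp_algebraMap]

lemma isLocalHom_completionMap [IsLocalRing (AdicCompletion 𝔪 R)]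
    (h : IsLocalRing.maximalIdeal (AdicCompletion 𝔪 R) = 𝔪.map (algebraMap R _)) :
    IsLocalHom (completionMap φ hφ) := by
  refine ((IsLocalRing.local_hom_TFAE (completionMap φ hφ)).out 0 2).2 ?_
  rw [h, Ideal.map_map,
    completionMap_comp_algebraMap, ← Ideal.map_map]
  exact Ideal.map_mono (Ideal.map_le_iff_le_comap.2 hφ)

lemma RingHom.Flat.of_forall_algHom_quotient_pow {R S B : Type*} [CommRing R] [CommRing S]
    [CommRing B] [Algebra R S] [IsNoetherianRing S] [IsNoetherianRing B] (g : S →+* B)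
    (hg : (g.comp (algebraMap R S)).Flat) (𝔞 : Ideal R) (θ : ∀ n, S →ₐ[R] R ⧸ 𝔞 ^ n)
    (hθ : ∀ n, RingHom.ker (θ n) ≤ (𝔞 ^ n).map (algebraMap R S))
    (hB : 𝔞.map (g.comp (algebraMap R S)) ≤ Ideal.jacobson ⊥) : g.Flat := by
  algebraize [g, g.comp (algebraMap R S)]
  exact Module.Flat.of_forall_algHom_quotient_pow 𝔞 θ hθ hB

/-- The composite R → R̂ → R̂ equals φ followed by R → R̂, hence is flat; the local criterion
removes the first arrow. -/
lemma flat_completionMap [IsNoetherianRing R] [IsLocalRing (AdicCompletion 𝔪 R)]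
    (h : IsLocalRing.maximalIdeal (AdicCompletion 𝔪 R) = 𝔪.map (algebraMap R _))
    (hflat : φ.Flat) : (completionMap φ hφ).Flat := by
  have hm := IsNoetherian.noetherian 𝔪
  refine .of_forall_algHom_quotient_pow _ ?_ 𝔪 (AdicCompletion.evalₐ 𝔪)
    (AdicCompletion.ker_evalₐ_le 𝔪 hm) ?_
  · rw [completionMap_comp_algebraMap]
    exact hflat.comp (RingHom.flat_algebraMap_iff.2 inferInstance)
  · rw [completionMap_comp_algebraMap, ← Ideal.map_map]
    refine (Ideal.map_mono (Ideal.map_le_iff_le_comap.2 hφ)).trans ?_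
    rw [← h]
    exact IsLocalRing.maximalIdeal_le_jacobson _

lemma IsCofinalFlatTriple.completion [IsNoetherianRing R] [IsLocalRing (AdicCompletion 𝔪 R)]
    (hm : IsLocalRing.maximalIdeal (AdicCompletion 𝔪 R) = 𝔪.map (algebraMap R _))
    {I : Ideal R} (h : IsCofinalFlatTriple I φ) :
    IsCofinalFlatTriple (I.map (algebraMap R (AdicCompletion 𝔪 R))) (completionMap φ hφ) where
  flat := flat_completionMap φ hφ hm h.flat
  antitone s t hst := by
    simp only [map_map_completionMap_pow]
    exact Ideal.map_mono (h.antitone hst)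
  exists_map_le_pow t := by
    obtain ⟨s, hs⟩ := h.exists_map_le_pow t
    refine ⟨s, ?_⟩
    rw [map_map_completionMap_pow, ← Ideal.map_pow]
    exact Ideal.map_mono hs
  exists_pow_le_map t := by
    obtain ⟨s, hs⟩ := h.exists_pow_le_map t
    refine ⟨s, ?_⟩
    rw [map_map_completionMap_pow, ← Ideal.map_pow]
    exact Ideal.map_mono hs

end CompletionMap

/-- The statement for the completion at a maximal ideal `𝔪` generated by `ht 𝔪` elements. -/
lemma completion_isCML_iff {R : Type u} [CommRing R] [IsNoetherianRing R] (𝔪 : Ideal R)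
    [𝔪.IsMaximal] (hreg : 𝔪.spanFinrank ≤ 𝔪.height) (I : Ideal R) (φ : R →+* R)
    (hφ : 𝔪 ≤ 𝔪.comap φ) (h : IsCofinalFlatTriple I φ) :
    ∃ (_ : IsRegularLocalRing (AdicCompletion 𝔪 R)) (_ : IsLocalHom (completionMap φ hφ))
      (h' : IsCofinalFlatTriple (I.map (algebraMap R (AdicCompletion 𝔪 R)))
        (completionMap φ hφ)),
      (h.IsCML 𝔪 ↔ h'.IsCML (IsLocalRing.maximalIdeal (AdicCompletion 𝔪 R))) := by
  have := AdicCompletion.isRegularLocalRing_of_spanFinrank_le_height 𝔪 hreg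
  have hm := (IsLocalRing.eq_maximalIdeal (AdicCompletion.isMaximal_map 𝔪)).symm
  refine ⟨this, isLocalHom_completionMap φ hφ hm, h.completion φ hφ hm, ?_⟩
  rw [hm]
  exact h.isCML_iff _ (map_map_completionMap_pow φ hφ I) 𝔪 (AdicCompletion.evalₐ 𝔪)
    (AdicCompletion.ker_evalₐ_le 𝔪 (IsNoetherian.noetherian 𝔪))

/-! ### Height and generators of the irrelevant ideal -/

section MvPolynomial

variable (n : ℕ) (k : Type*) [Field k]

lemma idealOfVars_eq_ker_constantCoeff :
    MvPolynomial.idealOfVars (Fin n) k = RingHom.ker MvPolynomial.constantCoeff := by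
  ext p
  rw [← pow_one (MvPolynomial.idealOfVars (Fin n) k), MvPolynomial.mem_pow_idealOfVars_iff',
    RingHom.mem_ker, MvPolynomial.constantCoeff_eq]
  refine ⟨fun h ↦ h 0 (by simp), fun h x hx ↦ ?_⟩
  obtain rfl : x = 0 := (Finsupp.degree_eq_zero_iff x).1 (by omega)
  exact h

lemma isMaximal_idealOfVars : (MvPolynomial.idealOfVars (Fin n) k).IsMaximal := by
  rw [idealOfVars_eq_ker_constantCoeff]
  exact RingHom.ker_isMaximal_of_surjective _ fun x ↦ ⟨MvPolynomial.C x, by simp⟩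

/-- The primes (x_1, …, x_i), realized as kernels of the substitutions killing the first i
variables, form a strict chain of length n. As kernels of maps to a domain they are visibly prime.
-/
lemma le_height_idealOfVars : n ≤ (MvPolynomial.idealOfVars (Fin n) k).height := by
  let f (i : ℕ) : MvPolynomial (Fin n) k →ₐ[k] MvPolynomial (Fin n) k :=
    MvPolynomial.aeval fun j ↦ if (j : ℕ) < i then 0 else MvPolynomial.X j
  have hf (i : ℕ) (j : Fin n) : f i (MvPolynomial.X j) = if (j : ℕ) < i then 0 else .X j :=
    MvPolynomial.aeval_X _ _
  have hprime (i : ℕ) : (RingHom.ker (f i)).IsPrime := RingHom.ker_isPrime _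
  have hlt (i : ℕ) (hi : i < n) : RingHom.ker (f i) < RingHom.ker (f (i + 1)) := by
    refine lt_of_le_of_ne (fun p hp ↦ ?_) fun h ↦ ?_
    · have h : (f (i + 1)).comp (f i) = f (i + 1) := by
        ext1 j
        rw [AlgHom.comp_apply, hf, hf]
        split_ifs with h₁ h₂ h₂
        · exact map_zero _
        · omega
        · rw [hf, if_pos h₂]
        · rw [hf, if_neg h₂]
      rw [RingHom.mem_ker] at hp ⊢
      rw [← h, AlgHom.comp_apply, hp, map_zero]
    · have : MvPolynomial.X ⟨i, hi⟩ ∈ RingHom.ker (f i) := by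
        rw [h, RingHom.mem_ker, hf, if_pos (Nat.lt_succ_self i)]
      rw [RingHom.mem_ker, hf, if_neg (lt_irrefl i)] at this
      exact MvPolynomial.X_ne_zero _ this
  have hle (i : ℕ) (hi : i ≤ n) : i ≤ (RingHom.ker (f i)).height := by
    induction i with
    | zero => simp
    | succ i ih =>
      push_cast
      exact (add_le_add_left (ih (by omega)) 1).trans
        (Ideal.height_add_one_le_of_lt_of_isPrime (hlt i hi))
  refine (hle n le_rfl).trans (Ideal.height_mono fun p hp ↦ ?_)
  have h : (MvPolynomial.constantCoeff (σ := Fin n) (R := k)).comp (f n).toRingHom =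
      MvPolynomial.constantCoeff := by
    ext j
    · simp
    · simp [hf]
  rw [idealOfVars_eq_ker_constantCoeff, RingHom.mem_ker, ← h, RingHom.comp_apply]
  exact (congrArg _ hp).trans (map_zero _)

lemma spanFinrank_idealOfVars_le : (MvPolynomial.idealOfVars (Fin n) k).spanFinrank ≤ n := by
  refine (Submodule.spanFinrank_span_le_ncard_of_finite (Set.finite_range _)).trans ?_
  rw [← Set.image_univ]
  exact (Set.ncard_image_le Set.finite_univ).trans (by simp)

end MvPolynomial

theorem mainTheorem11 :
    -- `R` a regular local ring, `φ` a local endomorphism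
    (∀ (R : Type u) [CommRing R] [IsRegularLocalRing R] (I : Ideal R) (φ : R →+* R)
        [IsLocalHom φ] (h : IsCofinalFlatTriple I φ),
      let R' := AdicCompletion (IsLocalRing.maximalIdeal R) R
      let φ' : R' →+* R' := completionMap φ (maximalIdeal_le_comap_of_isLocalHom φ)
      ∃ (_ : IsRegularLocalRing R') (_ : IsLocalHom φ')
        (h' : IsCofinalFlatTriple (I.map (algebraMap R R')) φ'),
        (h.IsCML (IsLocalRing.maximalIdeal R) ↔ h'.IsCML (IsLocalRing.maximalIdeal R'))) ∧
    -- `R = k[x_1, …, x_n]` standard graded, `I` homogeneous, `φ` a graded endomorphism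
    (∀ (n : ℕ) (k : Type v) [Field k] (I : Ideal (MvPolynomial (Fin n) k))
        (_ : I.IsHomogeneous (MvPolynomial.homogeneousSubmodule (Fin n) k))
        (φ : MvPolynomial (Fin n) k →+* MvPolynomial (Fin n) k)
        (hφ : IsGradedEndomorphism φ) (h : IsCofinalFlatTriple I φ),
      let R' := AdicCompletion (MvPolynomial.idealOfVars (Fin n) k) (MvPolynomial (Fin n) k)
      let φ' : R' →+* R' := completionMap φ (idealOfVars_le_comap_of_isGradedEndomorphism hφ)
      ∃ (_ : IsRegularLocalRing R') (_ : IsLocalHom φ')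
        (h' : IsCofinalFlatTriple (I.map (algebraMap (MvPolynomial (Fin n) k) R')) φ'),
        (h.IsCML (MvPolynomial.idealOfVars (Fin n) k) ↔
          h'.IsCML (IsLocalRing.maximalIdeal R'))) := by
  refine ⟨fun R _ _ I φ _ h ↦ completion_isCML_iff _ ?_ I φ _ h, fun n k _ I _ φ hφ h ↦ ?_⟩
  · have := IsRegularLocalRing.spanFinrank_maximalIdeal (R := R)
    rw [← IsLocalRing.maximalIdeal_height_eq_ringKrullDim] at this
    exact_mod_cast this.le
  · have := isMaximal_idealOfVars n k
    exact completion_isCML_iff _ ((Nat.cast_le.2 (spanFinrank_idealOfVars_le n k)).trans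
      (le_height_idealOfVars n k)) I φ _ h
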